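/- Let $\Gamma$ be a 4-dimensional Bieberbach group, i.e. a discrete, cocompact, torsion-free group of isometries of $\mathbb R^4$, whose translation lattice $\Lambda$ is the canonical lattice $\mathbb Z^4$. Let $F=\Lambda\backslash\Gamma$ be its holonomy group and $M_\Gamma=\Gamma\backslash\mathbb R^4$ the associated compact flat manifold. For $0\le p\le 4$ and $\operatorname{Re}(s)>0$ let $$Z_p^\Gamma(s)=\sum_{\lambda\in \mathrm{Spec}_p(M_\Gamma)} e^{-\lambda s}$$ be the $p$-heat trace, where $\mathrm{Spec}_p(M_\Gamma)$ is the collection of eigenvalues, counted with multiplicity, of the (nonnegative) Laplacian acting on smooth $p$-forms on $M_\Gamma$. Put $$\theta_0(s)=\sum_{m\in\mathbb Z}e^{-sm^2},\qquad \theta_1(s)=\sum_{m\in\mathbb Z}e^{-s(\frac12+m)^2},\qquad \phi_{d,r}(s)=\sum_{m\in\mathbb Z}e^{-s\left(\frac{m+r}{\sqrt d}\right)^2},$$ and, with the principal branch of the square root, $$x(s)=\frac{\theta_0(\frac1{4s})}{\sqrt{4\pi s}},\qquad y(s)=\frac{\theta_1(\frac1{4s})}{\sqrt{4\pi s}},\qquad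 z_{d,r}(s)=\frac{\phi_{d,r}(\frac1{4s})}{\sqrt{4\pi s}}.$$ Let $K=\mathbb Q(\sqrt2,\sqrt3)$. Then for every $p$ with $0\le p\le 4$ all eigenvalue multiplicities are finite, the series defining $Z_p^\Gamma(s)$ converges absolutely for $\operatorname{Re}(s)>0$, and there is a polynomial with coefficients in $K$, not depending on $s$, in the variables $x$, $y$, $z_{1,r}$, $z_{2,r}$, $z_{3,r}$, where $r=k/|F|$ and $0\le k\le |F|-1$, whose value at $x(s)$, $y(s)$, $z_{1,r}(s)$, $z_{2,r}(s)$, $z_{3,r}(s)$ is $Z_p^\Gamma(s)$ for all $s\in\mathbb C$ with $\operatorname{Re}(s)>0$. -/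

import Mathlib

open scoped ContDiff

noncomputable section

namespace FlatManifold

/-- Euclidean space of dimension `n`. -/
abbrev E (n : ℕ) := EuclideanSpace ℝ (Fin n)

/-- The isometry group of `ℝⁿ`: an element `γ` acts by `γ x = B x + B b`, where
`B = γ.linearIsometryEquiv` is its orthogonal part. -/
abbrev Iso (n : ℕ) := E n ≃ᵃⁱ[ℝ] E n

/-- The homomorphism sending an isometry `B L_b` to its orthogonal part `B`. -/
def linearPart (n : ℕ) : Iso n →* (E n ≃ₗᵢ[ℝ] E n) where
  toFun γ := γ.linearIsometryEquiv
  map_one' := rfl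
  map_mul' _ _ := rfl

/-- Translation by `v`. -/
def translation {n : ℕ} (v : E n) : Iso n := AffineIsometryEquiv.constVAdd ℝ (E n) v

/-- A Bieberbach group: a discrete, cocompact, torsion-free group of isometries of `ℝⁿ`. -/
structure IsBieberbach {n : ℕ} (Γ : Subgroup (Iso n)) : Prop where
  /-- The identity is isolated in `Γ`, for uniform convergence on compact sets. -/
  discrete : ∃ K : Set (E n), IsCompact K ∧ ∃ ε > 0,
    ∀ γ ∈ Γ, (∀ x ∈ K, dist (γ x) x < ε) → γ = 1
  /-- The translates of some compact set cover the space. -/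
  cocompact : ∃ K : Set (E n), IsCompact K ∧ ∀ x : E n, ∃ γ ∈ Γ, γ x ∈ K
  torsionFree : ∀ γ ∈ Γ, IsOfFinOrder γ → γ = 1

/-- The translations in `Γ` are exactly the translations by vectors of the canonical lattice
`ℤⁿ`. -/
def HasCanonicalLattice {n : ℕ} (Γ : Subgroup (Iso n)) : Prop :=
  ∀ v : E n, translation v ∈ Γ ↔ ∀ i, ∃ m : ℤ, v i = m

/-- The subgroup `Λ` of translations in `Γ`. -/
def translationSubgroup {n : ℕ} (Γ : Subgroup (Iso n)) : Subgroup Γ :=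
  ((linearPart n).comp Γ.subtype).ker

/-- The holonomy group `F = Γ / Λ`. -/
abbrev Holonomy {n : ℕ} (Γ : Subgroup (Iso n)) := Γ ⧸ translationSubgroup Γ

/-- The order `|F|` of the holonomy group. -/
def holonomyOrder {n : ℕ} (Γ : Subgroup (Iso n)) : ℕ := Nat.card (Holonomy Γ)

/-- The values of (complex-valued) `p`-forms at a point of `ℝⁿ`. -/
abbrev PForm (n p : ℕ) := E n [⋀^Fin p]→L[ℝ] ℂ

/-- The pullback `γ^* α` of a `p`-form by an isometry. -/
def pullback {n p : ℕ} (γ : Iso n) (α : E n → PForm n p) (x : E n) : PForm n p :=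
  (α (γ x)).compContinuousLinearMap
    (γ.linearIsometryEquiv.toContinuousLinearEquiv : E n →L[ℝ] E n)

/-- The space of smooth `p`-forms `α` on the flat manifold `Γ \ ℝⁿ` (that is, `Γ`-invariant smooth
`p`-forms on `ℝⁿ`) which satisfy `-Δ α = l α`. The metric being flat, the nonnegative
Laplacian on `p`-forms is minus the sum of the second partial derivatives
(`Laplacian.laplacian`), applied to the coefficients. -/
def eigenforms {n : ℕ} (Γ : Subgroup (Iso n)) (p : ℕ) (l : ℝ) :
    Submodule ℂ (E n → PForm n p) where
  carrier := {α | ContDiff ℝ ∞ α ∧ (∀ γ ∈ Γ, pullback γ α = α) ∧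
    ∀ x, -(Laplacian.laplacian α x) = (l : ℂ) • α x}
  zero_mem' := by
    refine ⟨contDiff_const, fun γ _ => ?_, fun x => ?_⟩
    · funext x; ext v; simp [pullback]
    · have h : Laplacian.laplacian (0 : E n → PForm n p) = 0 :=
        InnerProductSpace.laplacian_const (c := (0 : PForm n p))
      simp [h]
  add_mem' := by
    rintro α η ⟨h1, h2, h3⟩ ⟨k1, k2, k3⟩
    refine ⟨h1.add k1, fun γ hγ => ?_, fun x => ?_⟩
    · funext x
      have a := congrFun (h2 γ hγ) x
      have b := congrFun (k2 γ hγ) x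
      rw [Pi.add_apply, ← a, ← b]
      ext v; simp [pullback]
    · have h := ContDiffAt.laplacian_add (x := x)
        (contDiff_infty.mp h1 2).contDiffAt
        (contDiff_infty.mp k1 2).contDiffAt
      rw [h, neg_add, h3, k3, Pi.add_apply, smul_add]
  smul_mem' := by
    rintro c α ⟨h1, h2, h3⟩
    refine ⟨h1.const_smul c, fun γ hγ => ?_, fun x => ?_⟩
    · funext x
      have a := congrFun (h2 γ hγ) x
      rw [Pi.smul_apply, ← a]
      ext v; simp [pullback]
    · have h := InnerProductSpace.laplacian_smul (x := x) c
        ((contDiff_infty.mp h1 2).contDiffAt : ContDiffAt ℝ 2 α x)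
      rw [h, ← smul_neg, h3, Pi.smul_apply, smul_comm]

/-- The term `d_l e^{-l s}` of the heat trace on `p`-forms, where `d_l` is the multiplicity
of `l` as an eigenvalue of the Laplacian on `p`-forms (`0` if `l` is not an eigenvalue). -/
def heatTerm {n : ℕ} (Γ : Subgroup (Iso n)) (p : ℕ) (s : ℂ) (l : ℝ) : ℂ :=
  (Module.finrank ℂ (eigenforms Γ p l) : ℂ) * Complex.exp (-(l * s))

/-- The `p`-heat trace `Z_p^Γ(s)`: the sum of `e^{-l s}` over the spectrum of the Laplacian
on `p`-forms, with multiplicities. -/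
def heatTrace {n : ℕ} (Γ : Subgroup (Iso n)) (p : ℕ) (s : ℂ) : ℂ :=
  ∑' l : ℝ, heatTerm Γ p s l

def theta0 (s : ℂ) : ℂ := ∑' m : ℤ, Complex.exp (-s * (m : ℂ) ^ 2)

def theta1 (s : ℂ) : ℂ := ∑' m : ℤ, Complex.exp (-s * (1 / 2 + (m : ℂ)) ^ 2)

/-- The theta function `∑ e^{-s ((m + r)/√d)²}`, over the integers `m` (the possible values
of `m₁ + ⋯ + m_d`, each taken once). -/
def phi (d : ℕ) (r : ℝ) (s : ℂ) : ℂ :=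
  ∑' m : ℤ, Complex.exp (-s * (((m + r) / √(d : ℝ) : ℝ) : ℂ) ^ 2)

/-- The principal branch of `√(4 π s)`. -/
def sqrtFourPi (s : ℂ) : ℂ := (4 * (Real.pi : ℂ) * s) ^ (1 / 2 : ℂ)

def xFun (s : ℂ) : ℂ := theta0 (1 / (4 * s)) / sqrtFourPi s

def yFun (s : ℂ) : ℂ := theta1 (1 / (4 * s)) / sqrtFourPi s

def zFun (d : ℕ) (r : ℝ) (s : ℂ) : ℂ := phi d r (1 / (4 * s)) / sqrtFourPi s

/-- The variables `x`, `y` and `z_{d,k/N}` with `d = 1, 2, 3` and `0 ≤ k ≤ N - 1`; the index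
`i : Fin 3` of `z` stands for `d = i + 1`. -/
inductive HeatVar (N : ℕ) : Type
  | x : HeatVar N
  | y : HeatVar N
  | z (i : Fin 3) (k : Fin N) : HeatVar N

/-- The functions that are substituted for the variables. -/
def HeatVar.value {N : ℕ} (s : ℂ) : HeatVar N → ℂ
  | .x => xFun s
  | .y => yFun s
  | .z i k => zFun ((i : ℕ) + 1) ((k : ℝ) / (N : ℝ)) s

/-- The field `K = ℚ(√2, √3)`, as a subfield of `ℂ`. -/
abbrev K : IntermediateField ℚ ℂ :=
  IntermediateField.adjoin ℚ {((√2 : ℝ) : ℂ), ((√3 : ℝ) : ℂ)}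

end FlatManifold

end

/-! A `p`-form on the flat manifold is a form on the torus `ℝ⁴/ℤ⁴` invariant under the finite
holonomy group `F`. On the torus, the eigenspace of `l` is spanned by the plane waves `exp (2πi v⬝x)
c` with `4π²|v|² = l` (`eq_sum_coeff`), and averaging over `F` projects it onto the invariant forms.
The multiplicity is the trace of this projection (`HasCanonicalLattice.finrank_eigenforms`). A
pullback by `γ = B x + γ 0` permutes frequencies, so only the `v` fixed by the transpose of `B`
contribute. Hence `Z_p` is the mean over `F` of `tr B^*` times the sum of `exp (2πi v⬝γ 0 - 4π²|v|²
s)` over the fixed `v`.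

Since `B` preserves `ℤ⁴` and is orthogonal, it is a signed permutation matrix. Its fixed integer
vectors have an orthogonal basis of vectors with entries in `{0, ±1}` supported on cycles
(`exists_basis_fixed_lattice`), so the sum over fixed `v` is a product of one-dimensional theta
series (`hasSum_fixed`). Theta inversion (`latticeTheta_eq`) turns the series of a vector with `d`
nonzero entries into `z_{d,c}/√d`, where `c` is the scalar product of that vector with `γ 0`. The
factors `1/√d`, `d ≤ 4`, lie in `K`, and the traces `tr B^*` are rational.

It remains to control `c`. As `γ^|F|` is a lattice translation, `|F| c` is an integer. If `d = 4`,
then `B` is a signed 4-cycle with `B⁴ = 1`, which forces `c` itself to be an integer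
(`HasCanonicalLattice.exists_int_eq_pairing`). Then `z_{4,c} = x + y`, by splitting the integers by
parity, so no variables with `d = 4` are needed. -/

noncomputable section

namespace FlatManifold

/-! ### Fourier series of periodic eigenfunctions of the Laplacian. -/

section Fourier

open MeasureTheory UnitAddTorus

/-- The circle carries its normalised Haar measure, as in the theory of multiple Fourier series. -/
local instance : MeasureSpace UnitAddCircle := ⟨AddCircle.haarAddCircle⟩

local instance : Measure.IsAddHaarMeasure (volume : Measure UnitAddCircle) :=
  inferInstanceAs (Measure.IsAddHaarMeasure AddCircle.haarAddCircle)

local instance : IsProbabilityMeasure (volume : Measure UnitAddCircle) :=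
  inferInstanceAs (IsProbabilityMeasure AddCircle.haarAddCircle)

variable {n : ℕ} {W : Type*}

/-- The vector of `ℝⁿ` with integer coordinates `m`. -/
def intVec (m : Fin n → ℤ) : E n := WithLp.toLp 2 fun i => (m i : ℝ)

@[simp] lemma intVec_apply (m : Fin n → ℤ) (i : Fin n) : intVec m i = m i := rfl

/-- The `i`-th vector of the canonical basis of `ℝⁿ`. -/
def stdVec (i : Fin n) : E n := EuclideanSpace.single i 1

lemma stdVec_eq_intVec (i : Fin n) : stdVec i = intVec (Pi.single i 1) := by
  ext j
  by_cases h : j = i <;> simp [stdVec, h]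

/-- Functions on `ℝⁿ` that are invariant under translations by `ℤⁿ`. -/
def LatticePeriodic (f : E n → W) : Prop := ∀ x m, f (x + intVec m) = f x

/-- The character `x ↦ exp (2 π i v⬝x)`. -/
def character (v : Fin n → ℤ) (x : E n) : ℂ :=
  Complex.exp (2 * Real.pi * Complex.I * ∑ i, (v i : ℂ) * (x i : ℂ))

/-- The eigenvalue `4 π² |v|²` of the character of frequency `v`. -/
def eigenvalue (v : Fin n → ℤ) : ℝ := 4 * Real.pi ^ 2 * ∑ i, (v i : ℝ) ^ 2

/-- The projection of `ℝⁿ` to the standard torus. -/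
def toTorus (x : E n) : UnitAddTorus (Fin n) := fun i => (x i : UnitAddCircle)

/-- The function on the torus defined by a periodic function. -/
def descend (f : E n → W) (t : UnitAddTorus (Fin n)) : W :=
  f (WithLp.toLp 2 fun i => (AddCircle.equivIco 1 0 (t i) : ℝ))

lemma toTorus_section (t : UnitAddTorus (Fin n)) :
    toTorus (WithLp.toLp 2 fun i => (AddCircle.equivIco 1 0 (t i) : ℝ)) = t := by
  funext i
  exact (AddCircle.equivIco 1 0).symm_apply_apply (t i)

lemma exists_intVec_of_toTorus_eq {x y : E n} (h : toTorus x = toTorus y) :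
    ∃ m, x = y + intVec m := by
  have h1 (i : Fin n) : ∃ m : ℤ, x i = y i + m := by
    have := congrFun h i
    simp only [toTorus] at this
    rw [eq_comm, QuotientAddGroup.eq_iff_sub_mem] at this
    obtain ⟨k, hk⟩ := AddSubgroup.mem_zmultiples_iff.mp this
    refine ⟨-k, ?_⟩
    simp at hk
    push_cast
    linarith
  choose m hm using h1
  exact ⟨m, by ext i; simp [hm]⟩

lemma LatticePeriodic.descend_toTorus {f : E n → W} (hf : LatticePeriodic f) (x : E n) :
    descend f (toTorus x) = f x := by
  obtain ⟨m, hm⟩ := exists_intVec_of_toTorus_eq (toTorus_section (toTorus x))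
  rw [descend, hm, hf]

lemma isOpenQuotientMap_toTorus : IsOpenQuotientMap (toTorus (n := n)) := by
  have h1 : IsOpenQuotientMap (Pi.map fun (_ : Fin n) (x : ℝ) => (x : UnitAddCircle)) :=
    IsOpenQuotientMap.piMap fun _ => QuotientAddGroup.isOpenQuotientMap_mk
  exact h1.comp (EuclideanSpace.equiv (Fin n) ℝ).toHomeomorph.isOpenQuotientMap

lemma continuous_toTorus : Continuous (toTorus (n := n)) := isOpenQuotientMap_toTorus.continuous

lemma LatticePeriodic.continuous_descend [TopologicalSpace W] {f : E n → W}
    (hf : LatticePeriodic f) (h : Continuous f) : Continuous (descend f) := by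
  rw [isOpenQuotientMap_toTorus.isQuotientMap.continuous_iff]
  convert h using 1
  funext x
  exact hf.descend_toTorus x

lemma LatticePeriodic.fderiv [NormedAddCommGroup W] [NormedSpace ℝ W] {f : E n → W}
    (hf : LatticePeriodic f) (e : E n) : LatticePeriodic fun x => _root_.fderiv ℝ f x e := by
  intro x m
  have : (fun y => f (y + intVec m)) = f := funext fun y => hf y m
  show _root_.fderiv ℝ f (x + intVec m) e = _root_.fderiv ℝ f x e
  conv_rhs => rw [← this, fderiv_comp_add_right]

/-- The mean of a partial derivative of a periodic function vanishes. -/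
lemma LatticePeriodic.integral_descend_fderiv [NormedAddCommGroup W] [NormedSpace ℝ W]
    [CompleteSpace W] {g : E n → W} (hg : LatticePeriodic g) (h : ContDiff ℝ 1 g) (i : Fin n) :
    ∫ t, descend (fun x => _root_.fderiv ℝ g x (stdVec i)) t = 0 := by
  set k := fun x => _root_.fderiv ℝ g x (stdVec i) with hk
  have hkp : LatticePeriodic k := hg.fderiv _
  have hkc : Continuous k := (h.continuous_fderiv (by norm_num)).clm_apply continuous_const
  have hdc := hkp.continuous_descend hkc
  -- Integrate over the torus and over one period in direction `i`. The torus integral does not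
  -- depend on `s` by invariance of Haar measure, while the integral in `s` is a difference of
  -- values of `g` at points differing by a lattice vector. Fubini compares the two.
  let F : ℝ → UnitAddTorus (Fin n) → W := fun s t => descend k (t + toTorus (s • stdVec i))
  have hFc : Continuous (Function.uncurry F) := by
    refine hdc.comp (continuous_snd.add (continuous_toTorus.comp ?_))
    exact continuous_fst.smul continuous_const
  have h1 (s : ℝ) : ∫ t, F s t = ∫ t, descend k t :=
    integral_add_right_eq_self (descend k) _
  have h2 (t : UnitAddTorus (Fin n)) : ∫ s in (0 : ℝ)..1, F s t = 0 := by
    obtain ⟨x, rfl⟩ := isOpenQuotientMap_toTorus.surjective t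
    have hF (s : ℝ) : F s (toTorus x) = k (x + s • stdVec i) := by
      rw [← hkp.descend_toTorus]
      simp only [F]
      congr 1
    simp_rw [hF]
    have hd : ∀ s ∈ Set.uIcc (0 : ℝ) 1,
        HasDerivAt (fun s : ℝ => g (x + s • stdVec i)) (k (x + s • stdVec i)) s := by
      intro s _
      have hl : HasDerivAt (fun s : ℝ => x + s • stdVec i) (stdVec i) s := by
        simpa using ((hasDerivAt_id s).smul_const (stdVec i)).const_add x
      exact ((h.differentiable (by norm_num)) (x + s • stdVec i)).hasFDerivAt.comp_hasDerivAt s hl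
    rw [intervalIntegral.integral_eq_sub_of_hasDerivAt hd]
    · simp [stdVec_eq_intVec, hg x]
    · exact (hkc.comp (by fun_prop)).intervalIntegrable _ _
  have h3 : ∫ s in (0 : ℝ)..1, ∫ t, F s t = ∫ t, ∫ s in (0 : ℝ)..1, F s t := by
    apply intervalIntegral_integral_swap
    have : (volume.restrict (Set.uIoc (0 : ℝ) 1)).prod
        (volume : Measure (UnitAddTorus (Fin n))) =
        ((volume : Measure ℝ).prod volume).restrict (Set.uIoc 0 1 ×ˢ Set.univ) := by
      rw [← Measure.prod_restrict, Measure.restrict_univ]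
    rw [this]
    refine IntegrableOn.mono_set (t := Set.uIcc 0 1 ×ˢ Set.univ) ?_
      (Set.prod_mono Set.uIoc_subset_uIcc subset_rfl)
    exact hFc.continuousOn.integrableOn_compact (isCompact_uIcc.prod isCompact_univ)
  simp_rw [h1, h2] at h3
  simpa using h3

lemma character_add (v : Fin n → ℤ) (x y : E n) :
    character v (x + y) = character v x * character v y := by
  simp only [character, ← Complex.exp_add, PiLp.add_apply, Complex.ofReal_add, mul_add,
    Finset.sum_add_distrib]

lemma character_add_left (v w : Fin n → ℤ) (x : E n) :
    character (v + w) x = character v x * character w x := by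
  simp only [character, ← Complex.exp_add, Pi.add_apply, Int.cast_add, add_mul, mul_add,
    Finset.sum_add_distrib]

lemma character_zero (x : E n) : character 0 x = 1 := by simp [character]

lemma character_intVec (v m : Fin n → ℤ) : character v (intVec m) = 1 := by
  rw [character, Complex.exp_eq_one_iff]
  refine ⟨∑ i, v i * m i, ?_⟩
  simp only [intVec_apply, Complex.ofReal_intCast]
  push_cast
  ring

lemma latticePeriodic_character (v : Fin n → ℤ) : LatticePeriodic (character v) := fun x m => by
  rw [character_add, character_intVec, mul_one]

lemma mFourier_toTorus (v : Fin n → ℤ) (x : E n) : mFourier v (toTorus x) = character v x := by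
  simp only [mFourier, ContinuousMap.coe_mk, toTorus, character, fourier_coe_apply,
    Finset.mul_sum, Complex.exp_sum]
  refine Finset.prod_congr rfl fun i _ => ?_
  congr 1
  push_cast
  ring

lemma hasFDerivAt_character (v : Fin n → ℤ) (x : E n) :
    HasFDerivAt (character v) (character v x • (2 * Real.pi * Complex.I) •
      ∑ i, (v i : ℂ) • (Complex.ofRealCLM.comp (EuclideanSpace.proj i : E n →L[ℝ] ℝ))) x := by
  have h : HasFDerivAt (fun x : E n => 2 * (Real.pi : ℂ) * Complex.I *
      ∑ i, (v i : ℂ) * (x i : ℂ)) ((2 * (Real.pi : ℂ) * Complex.I) •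
      ∑ i, (v i : ℂ) • (Complex.ofRealCLM.comp (EuclideanSpace.proj i : E n →L[ℝ] ℝ))) x := by
    refine HasFDerivAt.const_mul ?_ _
    refine HasFDerivAt.fun_sum fun i _ => ?_
    exact HasFDerivAt.const_mul
      (Complex.ofRealCLM.comp (EuclideanSpace.proj i : E n →L[ℝ] ℝ)).hasFDerivAt _
  exact h.cexp

lemma contDiff_character (v : Fin n → ℤ) {k : WithTop ℕ∞} : ContDiff ℝ k (character v) := by
  have h (i : Fin n) : ContDiff ℝ k fun x : E n => (x i : ℂ) :=
    (Complex.ofRealCLM.comp (EuclideanSpace.proj i : E n →L[ℝ] ℝ)).contDiff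
  exact (contDiff_const.mul (ContDiff.sum fun i _ => contDiff_const.mul (h i))).cexp

lemma fderiv_character (v : Fin n → ℤ) (x : E n) (i : Fin n) :
    fderiv ℝ (character v) x (stdVec i) =
      2 * Real.pi * Complex.I * v i * character v x := by
  rw [(hasFDerivAt_character v x).fderiv]
  have h : ∑ j, (v j : ℂ) * ((stdVec i : E n) j : ℂ) = v i := by
    rw [Finset.sum_eq_single i (fun j _ hj => by simp [stdVec, hj]) (by simp)]
    simp [stdVec]
  simp only [smul_apply, sum_apply, smul_eq_mul,
    ContinuousLinearMap.comp_apply, Complex.ofRealCLM_apply, PiLp.proj_apply, h]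
  ring

lemma laplacian_eq_sum_fderiv [NormedAddCommGroup W] [NormedSpace ℝ W] {f : E n → W}
    (hf : ContDiff ℝ 2 f) (x : E n) :
    Laplacian.laplacian f x =
      ∑ i, fderiv ℝ (fun y => fderiv ℝ f y (stdVec i)) x (stdVec i) := by
  rw [InnerProductSpace.laplacian_eq_iteratedFDeriv_orthonormalBasis f
    (EuclideanSpace.basisFun (Fin n) ℝ)]
  refine Finset.sum_congr rfl fun i _ => ?_
  have hd : DifferentiableAt ℝ (fderiv ℝ f) x :=
    ((hf.fderiv_right (m := 1) (by norm_num)).differentiable (by norm_num)) x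
  rw [iteratedFDeriv_two_apply, fderiv_clm_apply hd (differentiableAt_const _)]
  simp [stdVec]

/-- The Fourier coefficient of frequency `v` of a periodic function. -/
def coeff [NormedAddCommGroup W] [NormedSpace ℂ W] (f : E n → W) (v : Fin n → ℤ) : W :=
  mFourierCoeff (descend f) v

lemma coeff_eq_integral [NormedAddCommGroup W] [NormedSpace ℂ W] (f : E n → W) (v : Fin n → ℤ) :
    coeff f v = ∫ t, descend (fun x => character (-v) x • f x) t := by
  refine integral_congr_ae (Filter.Eventually.of_forall fun t => ?_)
  simp only [descend]
  rw [← mFourier_toTorus, toTorus_section]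

lemma LatticePeriodic.character_smul [NormedAddCommGroup W] [NormedSpace ℂ W] {f : E n → W}
    (hf : LatticePeriodic f) (v : Fin n → ℤ) :
    LatticePeriodic fun x => character v x • f x := fun x m => by
  simp only [hf x m, latticePeriodic_character v x m]

lemma LatticePeriodic.integrable_descend [NormedAddCommGroup W] {f : E n → W}
    (hf : LatticePeriodic f) (h : Continuous f) : Integrable (descend f) := by
  rw [← integrableOn_univ]
  exact (hf.continuous_descend h).continuousOn.integrableOn_compact isCompact_univ

lemma LatticePeriodic.integrable_character_smul [NormedAddCommGroup W] [NormedSpace ℂ W]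
    {f : E n → W} (hf : LatticePeriodic f) (h : Continuous f) (v : Fin n → ℤ) :
    Integrable (descend fun x => character v x • f x) :=
  (hf.character_smul v).integrable_descend ((contDiff_character v (k := 0)).continuous.smul h)

/-- Green's identity, as a divergence: the field `χ_{-v} (∂ᵢ f + 2πi vᵢ f)` has divergence `χ_{-v}
(Δ f + 4π²|v|² f)`, because the first-order terms cancel. Its mean is zero, so `(4π²|v|² - l)`
annihilates the coefficient. -/
lemma eigenvalue_eq_zero_of_coeff_ne_zero {f : E n → ℂ} (hp : LatticePeriodic f)
    (hf : ContDiff ℝ 2 f) {l : ℝ} (hl : ∀ x, -(Laplacian.laplacian f x) = (l : ℂ) • f x)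
    {v : Fin n → ℤ} (hv : coeff f v ≠ 0) : eigenvalue v = l := by
  let D : Fin n → (E n → ℂ) → E n → ℂ := fun i g x => fderiv ℝ g x (stdVec i)
  have hDf (i : Fin n) : ContDiff ℝ 1 (D i f) :=
    (hf.fderiv_right (m := 1) (by norm_num)).clm_apply contDiff_const
  let g : Fin n → E n → ℂ := fun i x =>
    character (-v) x • (D i f x + 2 * Real.pi * Complex.I * v i * f x)
  have hgp (i : Fin n) : LatticePeriodic (g i) := by
    apply LatticePeriodic.character_smul
    intro x m
    have := hp.fderiv (stdVec i) x m
    simp only [D, this, hp x m]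
  have hgc (i : Fin n) : ContDiff ℝ 1 (g i) :=
    (contDiff_character (-v)).smul
      ((hDf i).add (contDiff_const.mul (hf.of_le (by norm_num))))
  have hDg (i : Fin n) (x : E n) : D i (g i) x =
      character (-v) x * (D i (D i f) x + 4 * Real.pi ^ 2 * (v i : ℂ) ^ 2 * f x) := by
    have h1 : DifferentiableAt ℝ (character (-v)) x :=
      (contDiff_character (-v) (k := 1)).differentiable (by norm_num) x
    have h2 : DifferentiableAt ℝ (D i f) x := (hDf i).differentiable (by norm_num) x
    have h3 : DifferentiableAt ℝ f x := hf.differentiable (by norm_num) x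
    have h4 : fderiv ℝ (g i) x = _ :=
      (h1.hasFDerivAt.mul (h2.hasFDerivAt.add (h3.hasFDerivAt.const_mul
        (2 * Real.pi * Complex.I * v i : ℂ)))).fderiv
    simp only [D] at h4 ⊢
    rw [h4]
    simp only [add_apply, smul_apply,
      fderiv_character, smul_eq_mul, Pi.neg_apply, Int.cast_neg, Pi.add_apply]
    ring_nf
    simp only [Complex.I_sq]
    ring
  have hsum : ∫ t, descend (fun x => ∑ i, D i (g i) x) t = 0 := by
    have h1 : ∫ t, ∑ i, descend (fun x => D i (g i) x) t = 0 := by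
      rw [integral_finsetSum]
      · exact Finset.sum_eq_zero fun i _ => (hgp i).integral_descend_fderiv (hgc i) i
      · intro i _
        exact ((hgp i).fderiv _).integrable_descend
          (((hgc i).continuous_fderiv (by norm_num)).clm_apply continuous_const)
    exact h1
  have hrw : (fun x => ∑ i, D i (g i) x) =
      fun x => ((eigenvalue v - l : ℝ) : ℂ) • (character (-v) x • f x) := by
    funext x
    have h1 : Laplacian.laplacian f x = ∑ i, D i (D i f) x := laplacian_eq_sum_fderiv hf x
    have h2 := hl x
    rw [h1, smul_eq_mul] at h2
    simp only [hDg, ← Finset.mul_sum, Finset.sum_add_distrib, ← Finset.sum_mul, eigenvalue,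
      smul_eq_mul]
    push_cast
    linear_combination (-character (-v) x) * h2
  rw [hrw] at hsum
  have h5 : ∫ t, ((eigenvalue v - l : ℝ) : ℂ) •
      descend (fun x => character (-v) x • f x) t = 0 := hsum
  rw [integral_smul, ← coeff_eq_integral, smul_eq_zero] at h5
  rcases h5 with h5 | h5
  · exact sub_eq_zero.mp (by exact_mod_cast h5)
  · exact absurd h5 hv

lemma finite_setOf_eigenvalue_eq (l : ℝ) : {v : Fin n → ℤ | eigenvalue v = l}.Finite := by
  obtain ⟨M, hM⟩ := exists_nat_gt l
  refine (Set.finite_Icc (fun _ : Fin n => -(M : ℤ)) fun _ => (M : ℤ)).subset ?_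
  intro v hv
  have h (i : Fin n) : |v i| ≤ (M : ℤ) := by
    have h1 : (v i : ℝ) ^ 2 ≤ ∑ j, (v j : ℝ) ^ 2 :=
      Finset.single_le_sum (f := fun j => (v j : ℝ) ^ 2) (fun j _ => sq_nonneg _)
        (Finset.mem_univ i)
    have h2 : 4 * Real.pi ^ 2 * ∑ j, (v j : ℝ) ^ 2 = l := hv
    have h3 : 1 ≤ 4 * Real.pi ^ 2 := by nlinarith [Real.pi_gt_three]
    have h4 : (v i : ℝ) ^ 2 ≤ M := by nlinarith [sq_nonneg (v i : ℝ)]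
    have h5 : (v i) ^ 2 ≤ (M : ℤ) := by exact_mod_cast h4
    have h6 : |v i| ≤ v i ^ 2 := by
      rw [Int.abs_eq_natAbs, ← Int.natAbs_sq, sq]
      exact_mod_cast Nat.le_mul_self _
    omega
  exact ⟨fun i => (abs_le.mp (h i)).1, fun i => (abs_le.mp (h i)).2⟩

/-- The frequencies of a given eigenvalue. -/
def frequencies (n : ℕ) (l : ℝ) : Finset (Fin n → ℤ) := (finite_setOf_eigenvalue_eq l).toFinset

@[simp] lemma mem_frequencies {v : Fin n → ℤ} {l : ℝ} :
    v ∈ frequencies n l ↔ eigenvalue v = l := by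
  simp [frequencies]

lemma coeff_clm_comp {V : Type*} [NormedAddCommGroup W] [NormedSpace ℂ W] [CompleteSpace W]
    [NormedAddCommGroup V] [NormedSpace ℂ V] [CompleteSpace V] (L : W →L[ℂ] V)
    {f : E n → W} (hp : LatticePeriodic f) (hf : Continuous f) (v : Fin n → ℤ) :
    coeff (fun x => L (f x)) v = L (coeff f v) := by
  rw [coeff_eq_integral, coeff_eq_integral,
    ← L.integral_comp_comm (hp.integrable_character_smul hf (-v))]
  simp only [descend, map_smul]

/-- Only finitely many frequencies have eigenvalue `l`, so the Fourier series is a finite sum and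
its pointwise convergence to `f` needs no decay estimate. -/
lemma eq_sum_coeff_of_complex {f : E n → ℂ} (hp : LatticePeriodic f)
    (hf : ContDiff ℝ 2 f) {l : ℝ} (hl : ∀ x, -(Laplacian.laplacian f x) = (l : ℂ) • f x)
    (x : E n) : f x = ∑ v ∈ frequencies n l, character v x • coeff f v := by
  let F : C(UnitAddTorus (Fin n), ℂ) := ⟨descend f, hp.continuous_descend hf.continuous⟩
  have h0 (v : Fin n → ℤ) (hv : v ∉ frequencies n l) : mFourierCoeff F v = 0 := by
    by_contra h
    exact hv (mem_frequencies.mpr (eigenvalue_eq_zero_of_coeff_ne_zero hp hf hl h))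
  have hs : Summable (mFourierCoeff F) := summable_of_ne_finset_zero h0
  have h1 := hasSum_mFourier_series_apply_of_summable hs (toTorus x)
  have h2 : F (toTorus x) = f x := hp.descend_toTorus x
  rw [h2] at h1
  rw [← h1.tsum_eq, tsum_eq_sum (s := frequencies n l)]
  · refine Finset.sum_congr rfl fun v _ => ?_
    rw [mFourier_toTorus, smul_eq_mul, smul_eq_mul, mul_comm]
    rfl
  · intro v hv
    rw [h0 v hv, zero_smul]

/-- A periodic eigenfunction of the Laplacian is a finite Fourier sum. -/
theorem eq_sum_coeff [NormedAddCommGroup W] [NormedSpace ℂ W] [CompleteSpace W] {f : E n → W}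
    (hp : LatticePeriodic f) (hf : ContDiff ℝ 2 f) {l : ℝ}
    (hl : ∀ x, -(Laplacian.laplacian f x) = (l : ℂ) • f x) (x : E n) :
    f x = ∑ v ∈ frequencies n l, character v x • coeff f v := by
  -- Continuous functionals separate points and commute with Fourier coefficients and the Laplacian,
  -- which reduces the claim to scalar functions.
  refine (SeparatingDual.eq_iff_forall_dual_eq (R := ℂ)).mpr fun L => ?_
  have hc : ContDiff ℝ 2 fun y => L (f y) := (L.restrictScalars ℝ).contDiff.comp hf
  have h := eq_sum_coeff_of_complex (f := fun y => L (f y)) (l := l) (fun y m => by simp [hp y m])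
    hc (fun y => ?_) x
  · rw [h, map_sum]
    refine Finset.sum_congr rfl fun v _ => ?_
    rw [coeff_clm_comp L hp hf.continuous, map_smul]
  · have h1 := (hf.contDiffAt (x := y)).laplacian_CLM_comp_left (l := L.restrictScalars ℝ)
    have h2 : Laplacian.laplacian (fun y => L (f y)) y = L (Laplacian.laplacian f y) := h1
    rw [h2, ← map_neg, hl, map_smul]

lemma coeff_character_smul [NormedAddCommGroup W] [NormedSpace ℂ W] [CompleteSpace W]
    (w v : Fin n → ℤ) (c : W) :
    coeff (fun x => character w x • c) v = if v = w then c else 0 := by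
  rw [coeff_eq_integral]
  have h (x : E n) : character (-v) x • character w x • c = character (w - v) x • c := by
    rw [smul_smul, ← character_add_left, neg_add_eq_sub]
  simp_rw [h]
  have h1 : ∫ t, descend (fun x => character (w - v) x • c) t =
      (∫ t, descend (character (w - v)) t) • c := by
    rw [← integral_smul_const]
    rfl
  rw [h1]
  split_ifs with hvw
  · subst hvw
    simp [descend, character_zero]
  -- A nontrivial character is a nonzero multiple of one of its own partial derivatives, hence has
  -- mean zero.
  · obtain ⟨i, hi⟩ : ∃ i, (w - v) i ≠ 0 := by
      by_contra! h0
      exact hvw (sub_eq_zero.mp (funext h0)).symm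
    have h2 := (latticePeriodic_character (w - v)).integral_descend_fderiv
      (contDiff_character _) i
    simp_rw [fderiv_character] at h2
    have h3 : ∫ t, (2 * Real.pi * Complex.I * ((w - v) i : ℤ) : ℂ) *
        descend (character (w - v)) t = 0 := h2
    rw [integral_const_mul, mul_eq_zero] at h3
    rcases h3 with h3 | h3
    · simp only [mul_eq_zero, Complex.ofReal_eq_zero, Real.pi_ne_zero, Complex.I_ne_zero,
        Int.cast_eq_zero, hi, OfNat.ofNat_ne_zero, or_self] at h3
    · rw [h3, zero_smul]

end Fourier

/-! ### Traces computed from a decomposition of the identity. -/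

section Trace

open Module

variable {ι V W : Type*} [AddCommGroup V] [Module ℂ V] [AddCommGroup W] [Module ℂ W]
  [FiniteDimensional ℂ W] {S : Finset ι} {J : ι → W →ₗ[ℂ] V} {Q : ι → V →ₗ[ℂ] W}

lemma finiteDimensional_of_sum_comp_eq_id (h : ∀ x, ∑ u ∈ S, J u (Q u x) = x) :
    FiniteDimensional ℂ V := by
  refine FiniteDimensional.of_injective (LinearMap.pi fun u : S => Q u) ?_
  rw [injective_iff_map_eq_zero]
  intro x hx
  rw [← h x]
  refine Finset.sum_eq_zero fun u hu => ?_
  have : Q u x = 0 := congrFun hx ⟨u, hu⟩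
  rw [this, map_zero]

/-- Insert `∑ J u ∘ Q u = id` and use cyclicity of the trace. No independence is required, so
redundant families are allowed. It serves both the coordinate forms and the plane waves. -/
lemma trace_eq_sum_trace_comp (h : ∀ x, ∑ u ∈ S, J u (Q u x) = x) (A : V →ₗ[ℂ] V) :
    LinearMap.trace ℂ V A = ∑ u ∈ S, LinearMap.trace ℂ W (Q u ∘ₗ A ∘ₗ J u) := by
  have := finiteDimensional_of_sum_comp_eq_id h
  have hA : A = ∑ u ∈ S, (A ∘ₗ J u) ∘ₗ Q u := by
    ext x
    conv_lhs => rw [← h x]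
    simp
  conv_lhs => rw [hA, map_sum]
  exact Finset.sum_congr rfl fun u _ => LinearMap.trace_comp_comm' _ _

end Trace

/-! ### Alternating forms in coordinates and the trace of a pullback. -/

section Forms

variable {n p : ℕ}

/-- The alternating form `(1 / p!) dx_{I 1} ∧ ⋯ ∧ dx_{I p}`. -/
def coordForm (I : Fin p → Fin n) : PForm n p :=
  ((p.factorial : ℂ)⁻¹) • ContinuousMultilinearMap.alternatization
    ((ContinuousMultilinearMap.mkPiAlgebra ℝ (Fin p) ℂ).compContinuousLinearMap
      fun k => Complex.ofRealCLM.comp (EuclideanSpace.proj (I k) : E n →L[ℝ] ℝ))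

lemma coordForm_apply (I : Fin p → Fin n) (v : Fin p → E n) :
    coordForm I v = (p.factorial : ℂ)⁻¹ *
      ∑ τ : Equiv.Perm (Fin p), (Equiv.Perm.sign τ : ℤ) • ∏ k, (v (τ k) (I k) : ℂ) := by
  simp [coordForm, ContinuousMultilinearMap.alternatization_apply_apply, Units.smul_def]

lemma apply_eq_sum_stdVec (c : PForm n p) (v : Fin p → E n) :
    c v = ∑ I : Fin p → Fin n, (∏ k, (v k (I k) : ℂ)) * c fun k => stdVec (I k) := by
  have h (k : Fin p) : v k = ∑ i, v k i • stdVec i := by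
    ext j
    simp [stdVec, Finset.sum_apply, Pi.single_apply]
  conv_lhs => rw [funext h]
  have h2 := c.toMultilinearMap.map_sum fun k i => v k i • stdVec i
  refine h2.trans (Finset.sum_congr rfl fun I _ => ?_)
  rw [MultilinearMap.map_smul_univ, ← Complex.coe_smul, smul_eq_mul, Complex.ofReal_prod]
  rfl

lemma sum_coordForm (c : PForm n p) :
    ∑ I : Fin p → Fin n, (c fun k => stdVec (I k)) • coordForm I = c := by
  ext v
  simp only [ContinuousAlternatingMap.sum_apply, ContinuousAlternatingMap.smul_apply,
    coordForm_apply, smul_eq_mul, Finset.mul_sum]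
  rw [Finset.sum_comm]
  -- The sum runs over all index tuples, not only increasing ones. Each permutation `τ` then
  -- contributes the same amount, its sign cancelling that of `c (v ∘ τ)`, and the `p!` permutations
  -- absorb the factor `1 / p!`.
  have h (τ : Equiv.Perm (Fin p)) :
      ∑ I : Fin p → Fin n, (c fun k => stdVec (I k)) *
        ((p.factorial : ℂ)⁻¹ * (Equiv.Perm.sign τ : ℤ) • ∏ k, (v (τ k) (I k) : ℂ)) =
      (p.factorial : ℂ)⁻¹ * c v := by
    have h1 : c (v ∘ τ) = (Equiv.Perm.sign τ : ℤ) • c v := by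
      have := c.toAlternatingMap.map_perm v τ
      rw [Units.smul_def] at this
      exact this
    have h2 : ((Equiv.Perm.sign τ : ℤ) : ℂ) * ((Equiv.Perm.sign τ : ℤ) : ℂ) = 1 := by
      rw [← Int.cast_mul, ← Units.val_mul, Int.units_mul_self]
      simp
    have h3 := apply_eq_sum_stdVec c (v ∘ τ)
    rw [h1, zsmul_eq_mul] at h3
    calc _ = (p.factorial : ℂ)⁻¹ * ((Equiv.Perm.sign τ : ℤ) : ℂ) *
          ∑ I : Fin p → Fin n, (∏ k, ((v ∘ τ) k (I k) : ℂ)) * c fun k => stdVec (I k) := by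
          rw [Finset.mul_sum]
          refine Finset.sum_congr rfl fun I _ => ?_
          simp only [zsmul_eq_mul, Function.comp]
          ring
      _ = _ := by
          rw [← h3]
          linear_combination (p.factorial : ℂ)⁻¹ * c v * h2
  rw [Finset.sum_congr rfl fun τ _ => h τ, Finset.sum_const, Finset.card_univ,
    Fintype.card_perm, Fintype.card_fin, nsmul_eq_mul, ← mul_assoc,
    mul_inv_cancel₀ (by exact_mod_cast p.factorial_ne_zero), one_mul]

/-- Evaluation of a form at vectors of the canonical basis. -/
def evalStd (I : Fin p → Fin n) : PForm n p →ₗ[ℂ] ℂ where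
  toFun c := c fun k => stdVec (I k)
  map_add' _ _ := rfl
  map_smul' _ _ := rfl

lemma sum_toSpanSingleton_evalStd (c : PForm n p) :
    ∑ I : Fin p → Fin n, LinearMap.toSpanSingleton ℂ (PForm n p) (coordForm I) (evalStd I c) =
      c := by
  simpa [evalStd] using sum_coordForm c

instance : FiniteDimensional ℂ (PForm n p) :=
  finiteDimensional_of_sum_comp_eq_id sum_toSpanSingleton_evalStd

/-- The action `B^*` of an isometry on the values of forms. -/
def formPullback (B : E n ≃ₗᵢ[ℝ] E n) : PForm n p →ₗ[ℂ] PForm n p where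
  toFun c := c.compContinuousLinearMap (B.toContinuousLinearEquiv : E n →L[ℝ] E n)
  map_add' _ _ := rfl
  map_smul' _ _ := rfl

/-- The coordinate forms factor the identity through copies of `ℂ`, so the trace is the sum of their
values at the images of basis vectors. These images are integral, and the only denominator is `p!`.
-/
lemma exists_rat_eq_trace_formPullback (B : E n ≃ₗᵢ[ℝ] E n)
    (hB : ∀ i j, ∃ m : ℤ, B (stdVec i) j = m) :
    ∃ r : ℚ, LinearMap.trace ℂ (PForm n p) (formPullback B) = r := by
  choose m hm using hB
  rw [trace_eq_sum_trace_comp sum_toSpanSingleton_evalStd]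
  refine ⟨∑ I : Fin p → Fin n, (p.factorial : ℚ)⁻¹ *
      ∑ τ : Equiv.Perm (Fin p), (Equiv.Perm.sign τ : ℤ) • ∏ k, (m (I (τ k)) (I k) : ℚ), ?_⟩
  push_cast
  refine Finset.sum_congr rfl fun I _ => ?_
  rw [LinearMap.trace_eq_matrix_trace ℂ (Module.Basis.singleton Unit ℂ)]
  simp only [Matrix.trace, Finset.univ_unique, Finset.sum_singleton, Matrix.diag,
    LinearMap.toMatrix_apply, Module.Basis.singleton_apply, Module.Basis.singleton_repr]
  simp only [LinearMap.comp_apply, LinearMap.toSpanSingleton_apply, one_smul]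
  have : evalStd I (formPullback B (coordForm I)) =
      coordForm I fun k => B (stdVec (I k)) := rfl
  rw [this, coordForm_apply]
  simp [hm]

end Forms

/-! ### Orthogonal parts as signed permutations; finiteness of the holonomy group. -/

section Holonomy

variable {n p : ℕ}

@[simp] lemma translation_apply (v x : E n) : translation v x = v + x := rfl

lemma linearIsometryEquiv_translation (v : E n) :
    (translation v).linearIsometryEquiv = LinearIsometryEquiv.refl ℝ (E n) :=
  rfl

lemma translation_mul (v w : E n) : translation v * translation w = translation (v + w) := by
  ext x
  simp [add_assoc]

lemma translation_zero : translation (0 : E n) = 1 := by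
  ext x
  simp

lemma apply_eq_linear_add (γ : Iso n) (x : E n) : γ x = γ.linearIsometryEquiv x + γ 0 := by
  simpa using γ.map_vadd 0 x

lemma eq_translation_of_linear_eq_one {γ : Iso n} (h : linearPart n γ = 1) :
    γ = translation (γ 0) := by
  ext x : 1
  have h1 : γ.linearIsometryEquiv = 1 := h
  rw [apply_eq_linear_add, h1, translation_apply, add_comm]
  rfl

lemma intVec_add (m k : Fin n → ℤ) : intVec (m + k) = intVec m + intVec k := by
  ext i
  simp

/-- The group of translations by `ℤⁿ`. -/
def latticeGroup (n : ℕ) : Subgroup (Iso n) where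
  carrier := {γ | ∃ m, γ = translation (intVec m)}
  one_mem' := ⟨0, by
    rw [← translation_zero]
    congr 1
    ext i
    simp⟩
  mul_mem' := by
    rintro _ _ ⟨m, rfl⟩ ⟨k, rfl⟩
    exact ⟨m + k, by rw [translation_mul, intVec_add]⟩
  inv_mem' := by
    rintro _ ⟨m, rfl⟩
    refine ⟨-m, ?_⟩
    rw [inv_eq_iff_mul_eq_one, translation_mul, ← intVec_add, add_neg_cancel]
    rw [← translation_zero]
    congr 1
    ext i
    simp

lemma translation_intVec_mem (m : Fin n → ℤ) : translation (intVec m) ∈ latticeGroup n :=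
  ⟨m, rfl⟩

lemma HasCanonicalLattice.latticeGroup_le {Γ : Subgroup (Iso n)} (h : HasCanonicalLattice Γ) :
    latticeGroup n ≤ Γ := by
  rintro _ ⟨m, rfl⟩
  exact (h _).mpr fun i => ⟨m i, rfl⟩

lemma HasCanonicalLattice.mem_latticeGroup {Γ : Subgroup (Iso n)} (h : HasCanonicalLattice Γ)
    {γ : Iso n} (hγ : γ ∈ Γ) (h1 : linearPart n γ = 1) : γ ∈ latticeGroup n := by
  rw [eq_translation_of_linear_eq_one h1] at hγ
  choose m hm using (h _).mp hγ
  refine ⟨m, ?_⟩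
  rw [eq_translation_of_linear_eq_one h1]
  congr 1
  ext i
  exact hm i

/-- The orthogonal map `B` sends the `i`-th basis vector to `ε i` times the `σ i`-th one. -/
def IsSignedPerm (B : E n ≃ₗᵢ[ℝ] E n) (σ : Equiv.Perm (Fin n)) (ε : Fin n → ℤˣ) : Prop :=
  ∀ x i, B x (σ i) = (ε i : ℤ) * x i

lemma eq_single_of_sum_sq_eq_one {ι : Type*} [Fintype ι] [DecidableEq ι] {m : ι → ℤ}
    (h : ∑ i, m i ^ 2 = 1) :
    ∃ j, ∃ e : ℤˣ, m = Pi.single j (e : ℤ) := by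
  obtain ⟨j, hj⟩ : ∃ j, m j ≠ 0 := by
    by_contra! h0
    simp [h0] at h
  have h1 : m j ^ 2 + ∑ i ∈ Finset.univ.erase j, m i ^ 2 = 1 := by
    rw [← h, Finset.add_sum_erase _ (fun i => m i ^ 2) (Finset.mem_univ j)]
  have h2 : 0 < m j ^ 2 := by positivity
  have h3 : 0 ≤ ∑ i ∈ Finset.univ.erase j, m i ^ 2 := Finset.sum_nonneg fun i _ => sq_nonneg _
  have h4 : ∑ i ∈ Finset.univ.erase j, m i ^ 2 = 0 := by omega
  have h5 : m j ^ 2 = 1 := by omega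
  rw [Finset.sum_eq_zero_iff_of_nonneg fun i _ => sq_nonneg _] at h4
  obtain ⟨e, he⟩ : IsUnit (m j) :=
    (isUnit_pow_iff two_ne_zero).mp (h5 ▸ isUnit_one)
  refine ⟨j, e, ?_⟩
  funext i
  by_cases hi : i = j
  · subst hi
    simp [he]
  · have := h4 i (Finset.mem_erase.mpr ⟨hi, Finset.mem_univ i⟩)
    simp [hi, pow_eq_zero_iff (two_ne_zero) |>.mp this]

/-- Conjugating a translation by `γ` applies `B` to its vector, so `B` maps `ℤⁿ` into itself. An
integer vector of norm one is plus or minus a basis vector, and orthogonality makes the resulting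
map of indices injective. -/
lemma HasCanonicalLattice.exists_isSignedPerm {Γ : Subgroup (Iso n)}
    (h : HasCanonicalLattice Γ) {γ : Iso n} (hγ : γ ∈ Γ) :
    ∃ σ ε, IsSignedPerm γ.linearIsometryEquiv σ ε := by
  set B := γ.linearIsometryEquiv with hB
  have hcol (i : Fin n) : ∃ j, ∃ e : ℤˣ, B (stdVec i) = ((e : ℤ) : ℝ) • stdVec j := by
    have h1 : translation (B (stdVec i)) = γ * translation (stdVec i) * γ⁻¹ := by
      rw [eq_mul_inv_iff_mul_eq]
      ext x : 1
      show B (stdVec i) + γ x = γ (stdVec i + x)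
      rw [apply_eq_linear_add γ x, apply_eq_linear_add γ (stdVec i + x), map_add, hB]
      abel
    have h2 : translation (B (stdVec i)) ∈ Γ := by
      rw [h1, stdVec_eq_intVec]
      exact Γ.mul_mem (Γ.mul_mem hγ (h.latticeGroup_le (translation_intVec_mem _)))
        (Γ.inv_mem hγ)
    choose m hm using (h _).mp h2
    have h3 : ‖B (stdVec i)‖ = 1 := by
      rw [B.norm_map]
      simp [stdVec]
    have h4 : ∑ j, m j ^ 2 = 1 := by
      have h5 := EuclideanSpace.norm_sq_eq (B (stdVec i))
      simp only [h3, hm, Real.norm_eq_abs, sq_abs] at h5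
      have h6 : ((∑ j, m j ^ 2 : ℤ) : ℝ) = 1 := by
        push_cast
        linarith
      exact_mod_cast h6
    obtain ⟨j, e, he⟩ := eq_single_of_sum_sq_eq_one h4
    refine ⟨j, e, ?_⟩
    ext k
    rw [hm, he]
    by_cases hk : k = j
    · subst hk
      simp [stdVec]
    · simp [stdVec, hk]
  choose σ ε hσ using hcol
  have hinj : Function.Injective σ := by
    intro i k hik
    by_contra hne
    have h1 : inner ℝ (B (stdVec i)) (B (stdVec k)) = 0 := by
      rw [B.inner_map_map]
      simp [stdVec, EuclideanSpace.inner_single_left, hne]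
    rw [hσ, hσ, hik, inner_smul_left, inner_smul_right] at h1
    simp [stdVec] at h1
  let τ := Equiv.ofBijective σ (Finite.injective_iff_bijective.mp hinj)
  refine ⟨τ, ε, fun x i => ?_⟩
  have hx : x = ∑ k, x k • stdVec k := by
    ext j
    simp [stdVec, Finset.sum_apply, Pi.single_apply]
  have h2 : B x = ∑ k, x k • B (stdVec k) := by
    conv_lhs => rw [hx]
    simp
  rw [h2]
  have h3 : (∑ k, x k • B (stdVec k)) (τ i) = ∑ k, x k * ((ε k : ℤ) * stdVec (σ k) (σ i)) := by
    simp [hσ, τ]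
  rw [h3, Finset.sum_eq_single i]
  · simp [stdVec]
    ring
  · intro k _ hk
    have : σ i ≠ σ k := fun h => hk (hinj h).symm
    simp [stdVec, this]
  · simp

/-- The transpose of a signed permutation matrix, acting on frequencies. -/
def dualAct (σ : Equiv.Perm (Fin n)) (ε : Fin n → ℤˣ) (v : Fin n → ℤ) (i : Fin n) : ℤ :=
  ε i * v (σ i)

lemma eigenvalue_dualAct (σ : Equiv.Perm (Fin n)) (ε : Fin n → ℤˣ) (v : Fin n → ℤ) :
    eigenvalue (dualAct σ ε v) = eigenvalue v := by
  have h (i : Fin n) : ((dualAct σ ε v i : ℤ) : ℝ) ^ 2 = (v (σ i) : ℝ) ^ 2 := by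
    rcases Int.units_eq_one_or (ε i) with h | h <;> simp [dualAct, h]
  simp only [eigenvalue, h]
  rw [Equiv.sum_comp σ fun i => (v i : ℝ) ^ 2]

lemma IsSignedPerm.character_apply {B : E n ≃ₗᵢ[ℝ] E n} {σ : Equiv.Perm (Fin n)}
    {ε : Fin n → ℤˣ} (h : IsSignedPerm B σ ε) (v : Fin n → ℤ) (x : E n) :
    character v (B x) = character (dualAct σ ε v) x := by
  unfold character
  rw [← Equiv.sum_comp σ]
  congr 2
  refine Finset.sum_congr rfl fun i _ => ?_
  rw [h x i, dualAct]
  push_cast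
  ring

lemma IsSignedPerm.exists_int {B : E n ≃ₗᵢ[ℝ] E n} {σ : Equiv.Perm (Fin n)}
    {ε : Fin n → ℤˣ} (h : IsSignedPerm B σ ε) (i j : Fin n) :
    ∃ m : ℤ, B (stdVec i) j = m := by
  obtain ⟨k, rfl⟩ := σ.surjective j
  rw [h, stdVec_eq_intVec, intVec_apply]
  exact ⟨ε k * (Pi.single i 1 : Fin n → ℤ) k, by push_cast; rfl⟩

lemma IsSignedPerm.ext {B C : E n ≃ₗᵢ[ℝ] E n} {σ : Equiv.Perm (Fin n)}
    {ε : Fin n → ℤˣ} (h : IsSignedPerm B σ ε) (h' : IsSignedPerm C σ ε) : B = C := by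
  ext x i
  obtain ⟨k, rfl⟩ := σ.surjective i
  rw [h, h']

lemma HasCanonicalLattice.finite_holonomy {Γ : Subgroup (Iso n)} (h : HasCanonicalLattice Γ) :
    Finite (Holonomy Γ) := by
  choose σ ε hs using fun γ : Γ => h.exists_isSignedPerm γ.2
  refine Finite.of_injective (fun q : Holonomy Γ => (σ q.out, ε q.out)) fun q r hqr => ?_
  simp only [Prod.mk.injEq] at hqr
  have h1 := hs q.out
  rw [hqr.1, hqr.2] at h1
  have h2 : linearPart n (q.out : Iso n) = linearPart n (r.out : Iso n) := h1.ext (hs r.out)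
  rw [← QuotientGroup.out_eq' q, ← QuotientGroup.out_eq' r, QuotientGroup.eq]
  show linearPart n ((q.out⁻¹ * r.out : Γ) : Iso n) = 1
  simp [h2]

end Holonomy

/-! ### Multiplicities as traces of averaged pullbacks. -/

section Multiplicity

lemma finrank_eq_trace_of_isProj {M : Type*} [AddCommGroup M] [Module ℂ M]
    {U V : Submodule ℂ M} [FiniteDimensional ℂ V] (hUV : U ≤ V) (A : V →ₗ[ℂ] V)
    (h1 : ∀ x, (A x : M) ∈ U) (h2 : ∀ x : V, (x : M) ∈ U → A x = x) :
    (Module.finrank ℂ U : ℂ) = LinearMap.trace ℂ V A := by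
  have hA : LinearMap.IsProj (U.comap V.subtype) A := ⟨h1, h2⟩
  rw [hA.trace, (Submodule.comapSubtypeEquivOfLe hUV).finrank_eq]

variable {n p : ℕ}

lemma pullback_mul (γ δ : Iso n) (α : E n → PForm n p) :
    pullback (γ * δ) α = pullback δ (pullback γ α) := rfl

/-- The pullback of forms as a linear map. -/
def pullbackₗ (γ : Iso n) : (E n → PForm n p) →ₗ[ℂ] (E n → PForm n p) where
  toFun := pullback γ
  map_add' _ _ := rfl
  map_smul' _ _ := rfl

lemma pullback_apply (γ : Iso n) (α : E n → PForm n p) (x : E n) :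
    pullback γ α x = formPullback γ.linearIsometryEquiv (α (γ x)) := rfl

lemma formPullback_refl (c : PForm n p) :
    formPullback (LinearIsometryEquiv.refl ℝ (E n)) c = c := by
  ext v
  rfl

lemma pullback_translation (v : E n) (α : E n → PForm n p) (x : E n) :
    pullback (translation v) α x = α (x + v) := by
  rw [pullback_apply, linearIsometryEquiv_translation, formPullback_refl, translation_apply,
    add_comm]

lemma latticePeriodic_of_mem_eigenforms {l : ℝ} {α : E n → PForm n p}
    (h : α ∈ eigenforms (latticeGroup n) p l) : LatticePeriodic α := fun x m => by
  rw [← pullback_translation (intVec m) α x, h.2.1 _ (translation_intVec_mem m)]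

lemma laplacian_character_smul (v : Fin n → ℤ) (c : PForm n p) (x : E n) :
    Laplacian.laplacian (fun x => character v x • c) x =
      -((eigenvalue v : ℂ) • character v x • c) := by
  have hd (x : E n) : DifferentiableAt ℝ (character v) x :=
    (contDiff_character v (k := 1)).differentiable (by norm_num) x
  have h1 (i : Fin n) (b : PForm n p) (x : E n) :
      fderiv ℝ (fun x => character v x • b) x (stdVec i) =
        character v x • (2 * Real.pi * Complex.I * v i : ℂ) • b := by
    rw [fderiv_fun_smul (hd x) (differentiableAt_const b)]
    simp [fderiv_character, smul_smul]
    ring_nf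
  have h2 : ContDiff ℝ 2 fun x => character v x • c :=
    (contDiff_character v).smul contDiff_const
  rw [laplacian_eq_sum_fderiv h2]
  simp_rw [h1]
  simp only [smul_smul, ← Finset.sum_smul]
  refine Eq.trans ?_ (neg_smul _ _)
  congr 1
  simp only [eigenvalue]
  push_cast
  simp only [Finset.mul_sum, ← Finset.sum_neg_distrib, Finset.sum_mul]
  refine Finset.sum_congr rfl fun i _ => ?_
  ring_nf
  simp only [Complex.I_sq]
  ring

/-- The form `x ↦ exp (2 π i v⬝x) c`. -/
def planeWave (v : Fin n → ℤ) : PForm n p →ₗ[ℂ] (E n → PForm n p) where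
  toFun c x := character v x • c
  map_add' _ _ := funext fun _ => smul_add _ _ _
  map_smul' _ _ := funext fun _ => smul_comm _ _ _

lemma planeWave_apply (v : Fin n → ℤ) (c : PForm n p) (x : E n) :
    planeWave v c x = character v x • c := rfl

lemma planeWave_mem (v : Fin n → ℤ) (c : PForm n p) :
    planeWave v c ∈ eigenforms (latticeGroup n) p (eigenvalue v) := by
  refine ⟨(contDiff_character v).smul contDiff_const, ?_, fun x => ?_⟩
  · rintro _ ⟨m, rfl⟩
    funext x
    rw [pullback_translation, planeWave_apply, latticePeriodic_character, planeWave_apply]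
  · rw [planeWave_apply, ← neg_eq_iff_eq_neg.mpr (laplacian_character_smul v c x)]
    rfl

lemma pullback_planeWave {γ : Iso n} {σ : Equiv.Perm (Fin n)} {ε : Fin n → ℤˣ}
    (h : IsSignedPerm γ.linearIsometryEquiv σ ε) (v : Fin n → ℤ) (c : PForm n p) :
    pullback γ (planeWave v c) =
      planeWave (dualAct σ ε v) (character v (γ 0) • formPullback γ.linearIsometryEquiv c) := by
  funext x
  rw [pullback_apply, planeWave_apply, planeWave_apply, apply_eq_linear_add γ x, character_add,
    h.character_apply, map_smul, smul_smul]

lemma eq_sum_planeWave {l : ℝ} {α : E n → PForm n p}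
    (h : α ∈ eigenforms (latticeGroup n) p l) :
    ∑ v ∈ frequencies n l, planeWave v (coeff α v) = α := by
  funext x
  rw [eq_sum_coeff (latticePeriodic_of_mem_eigenforms h) (contDiff_infty.mp h.1 2) h.2.2,
    Finset.sum_apply]
  rfl

/-- Checked on plane waves: the pullback of one is another plane wave whose frequency has the same
norm. This replaces a chain rule for the Laplacian and gives periodicity as well. -/
lemma pullback_mem_eigenforms {γ : Iso n} {σ : Equiv.Perm (Fin n)} {ε : Fin n → ℤˣ}
    (hs : IsSignedPerm γ.linearIsometryEquiv σ ε) {l : ℝ} {α : E n → PForm n p}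
    (h : α ∈ eigenforms (latticeGroup n) p l) :
    pullbackₗ γ α ∈ eigenforms (latticeGroup n) p l := by
  rw [← eq_sum_planeWave h, map_sum]
  refine Submodule.sum_mem _ fun v hv => ?_
  rw [mem_frequencies] at hv
  have h1 : pullbackₗ γ (planeWave v (coeff α v)) = _ := pullback_planeWave hs v (coeff α v)
  rw [h1, ← hv, ← eigenvalue_dualAct σ ε v]
  exact planeWave_mem _ _

/-- Fourier coefficients of `ℤⁿ`-periodic eigenforms, as linear maps. -/
def coeffₗ (l : ℝ) (v : Fin n → ℤ) : eigenforms (latticeGroup n) p l →ₗ[ℂ] PForm n p where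
  toFun α := coeff (α : E n → PForm n p) v
  map_add' α β := by
    have h (α : eigenforms (latticeGroup n) p l) :=
      (latticePeriodic_of_mem_eigenforms α.2).integrable_character_smul α.2.1.continuous (-v)
    simp only [coeff_eq_integral]
    rw [← MeasureTheory.integral_add (h α) (h β)]
    simp [descend]
  map_smul' c α := by
    simp only [coeff_eq_integral, RingHom.id_apply]
    rw [← MeasureTheory.integral_smul]
    simp only [descend, Submodule.coe_smul, Pi.smul_apply]
    congr 1
    funext t
    rw [smul_comm]

open Classical in
/-- The plane wave of frequency `v` as an eigenform of eigenvalue `l`, if `l` is the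
eigenvalue of `v`. -/
def planeWaveₗ (l : ℝ) (v : Fin n → ℤ) : PForm n p →ₗ[ℂ] eigenforms (latticeGroup n) p l :=
  if h : eigenvalue v = l then (planeWave v).codRestrict _ fun c => h ▸ planeWave_mem v c else 0

lemma coe_planeWaveₗ {l : ℝ} {v : Fin n → ℤ} (h : eigenvalue v = l) (c : PForm n p) :
    (planeWaveₗ l v c : E n → PForm n p) = planeWave v c := by
  rw [planeWaveₗ, dif_pos h]
  rfl

lemma sum_planeWaveₗ {l : ℝ} (α : eigenforms (latticeGroup n) p l) :
    ∑ v ∈ frequencies n l, planeWaveₗ l v (coeffₗ l v α) = α := by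
  apply Subtype.ext
  rw [AddSubmonoidClass.coe_finsetSum]
  refine Eq.trans (Finset.sum_congr rfl fun v hv => ?_) (eq_sum_planeWave α.2)
  rw [coe_planeWaveₗ (mem_frequencies.mp hv)]
  rfl

instance (l : ℝ) : FiniteDimensional ℂ (eigenforms (latticeGroup n) p l) :=
  finiteDimensional_of_sum_comp_eq_id sum_planeWaveₗ

/-- The pullback as an endomorphism of the space of `ℤⁿ`-periodic eigenforms. -/
def eigenPullback {γ : Iso n} {σ : Equiv.Perm (Fin n)} {ε : Fin n → ℤˣ}
    (hs : IsSignedPerm γ.linearIsometryEquiv σ ε) (p : ℕ) (l : ℝ) :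
    eigenforms (latticeGroup n) p l →ₗ[ℂ] eigenforms (latticeGroup n) p l :=
  (pullbackₗ γ).restrict fun _ h => pullback_mem_eigenforms hs h

/-- The pullback sends the block of frequency `v` to that of `dualAct σ ε v`, so a diagonal block is
nonzero only at fixed frequencies. -/
lemma trace_eigenPullback {γ : Iso n} {σ : Equiv.Perm (Fin n)} {ε : Fin n → ℤˣ}
    (hs : IsSignedPerm γ.linearIsometryEquiv σ ε) (p : ℕ) (l : ℝ) :
    LinearMap.trace ℂ (eigenforms (latticeGroup n) p l) (eigenPullback hs p l) =
      ∑ v ∈ frequencies n l, if dualAct σ ε v = v then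
        character v (γ 0) * LinearMap.trace ℂ (PForm n p) (formPullback γ.linearIsometryEquiv)
      else 0 := by
  rw [trace_eq_sum_trace_comp (V := eigenforms (latticeGroup n) p l) (W := PForm n p)
    (S := frequencies n l) (J := planeWaveₗ l) (Q := coeffₗ l) sum_planeWaveₗ]
  refine Finset.sum_congr rfl fun v hv => ?_
  have h (c : PForm n p) : coeffₗ l v (eigenPullback hs p l (planeWaveₗ l v c)) =
      if v = dualAct σ ε v then
        character v (γ 0) • formPullback γ.linearIsometryEquiv c else 0 := by
    have h1 : (eigenPullback hs p l (planeWaveₗ l v c) : E n → PForm n p) =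
        planeWave (dualAct σ ε v)
          (character v (γ 0) • formPullback γ.linearIsometryEquiv c) := by
      rw [← pullback_planeWave hs, ← coe_planeWaveₗ (mem_frequencies.mp hv)]
      rfl
    rw [← coeff_character_smul]
    exact congrArg (fun f => coeff f v) h1
  split_ifs with hvw
  · have : coeffₗ l v ∘ₗ eigenPullback hs p l ∘ₗ planeWaveₗ l v =
        character v (γ 0) • formPullback (p := p) γ.linearIsometryEquiv := by
      ext1 c
      rw [LinearMap.comp_apply, LinearMap.comp_apply, h, if_pos hvw.symm]
      rfl
    rw [this, map_smul, smul_eq_mul]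
  · have : coeffₗ l v ∘ₗ eigenPullback hs p l ∘ₗ planeWaveₗ l v = 0 := by
      ext1 c
      rw [LinearMap.comp_apply, LinearMap.comp_apply, h, if_neg fun h => hvw h.symm]
      rfl
    rw [this, map_zero]

variable {Γ : Subgroup (Iso n)}

instance : (translationSubgroup Γ).Normal := MonoidHom.normal_ker _

lemma HasCanonicalLattice.eigenforms_le (h : HasCanonicalLattice Γ) (p : ℕ) (l : ℝ) :
    eigenforms Γ p l ≤ eigenforms (latticeGroup n) p l :=
  fun _ hα => ⟨hα.1, fun γ hγ => hα.2.1 γ (h.latticeGroup_le hγ), hα.2.2⟩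

lemma HasCanonicalLattice.finiteDimensional_eigenforms (h : HasCanonicalLattice Γ) (p : ℕ)
    (l : ℝ) : FiniteDimensional ℂ (eigenforms Γ p l) :=
  Submodule.finiteDimensional_of_le (h.eigenforms_le p l)

/-- Lattice-periodic forms are pulled back in the same way by elements with the same class in the
holonomy group. -/
lemma HasCanonicalLattice.pullback_eq_of_mk_eq (h : HasCanonicalLattice Γ) {l : ℝ}
    {α : E n → PForm n p} (hα : α ∈ eigenforms (latticeGroup n) p l) {γ δ : Γ}
    (hγδ : (γ : Holonomy Γ) = δ) : pullback (γ : Iso n) α = pullback (δ : Iso n) α := by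
  have h1 : linearPart n ((γ⁻¹ * δ : Γ) : Iso n) = 1 := QuotientGroup.eq.mp hγδ
  have h2 := h.mem_latticeGroup (γ⁻¹ * δ).2 h1
  obtain ⟨σ, ε, hs⟩ := h.exists_isSignedPerm γ.2
  have h3 := (pullback_mem_eigenforms hs hα).2.1 _ h2
  have h4 : (δ : Iso n) = γ * (γ⁻¹ * δ : Γ) := by simp
  rw [h4, pullback_mul]
  exact h3.symm

/-- The character formula for the multiplicity of an eigenvalue of the Laplacian on a flat
manifold. -/
theorem HasCanonicalLattice.finrank_eigenforms (h : HasCanonicalLattice Γ)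
    [Fintype (Holonomy Γ)] {σ : Holonomy Γ → Equiv.Perm (Fin n)} {ε : Holonomy Γ → Fin n → ℤˣ}
    (hs : ∀ q : Holonomy Γ, IsSignedPerm (q.out : Iso n).linearIsometryEquiv (σ q) (ε q))
    (p : ℕ) (l : ℝ) :
    (Module.finrank ℂ (eigenforms Γ p l) : ℂ) = (holonomyOrder Γ : ℂ)⁻¹ *
      ∑ q : Holonomy Γ, ∑ v ∈ frequencies n l, if dualAct (σ q) (ε q) v = v then
        character v ((q.out : Iso n) 0) *
          LinearMap.trace ℂ (PForm n p) (formPullback (q.out : Iso n).linearIsometryEquiv)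
      else 0 := by
  let V := eigenforms (latticeGroup n) p l
  -- The average over `F`, through arbitrary representatives: lattice translations act trivially on
  -- `V`.
  let A : V →ₗ[ℂ] V := (holonomyOrder Γ : ℂ)⁻¹ • ∑ q, eigenPullback (hs q) p l
  have hN : holonomyOrder Γ = Fintype.card (Holonomy Γ) := Nat.card_eq_fintype_card
  have hN0 : (holonomyOrder Γ : ℂ) ≠ 0 := by
    rw [hN]
    exact_mod_cast Fintype.card_ne_zero
  have hA (α : V) : (A α : E n → PForm n p) =
      (holonomyOrder Γ : ℂ)⁻¹ • ∑ q : Holonomy Γ, pullback (q.out : Iso n) α := by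
    simp only [A, LinearMap.smul_apply, LinearMap.sum_apply, Submodule.coe_smul,
      AddSubmonoidClass.coe_finsetSum]
    rfl
  have hproj : (∀ α, (A α : E n → PForm n p) ∈ eigenforms Γ p l) ∧
      ∀ α : V, (α : E n → PForm n p) ∈ eigenforms Γ p l → A α = α := by
    refine ⟨fun α => ?_, fun α hα => ?_⟩
    · refine ⟨(A α).2.1, fun γ hγ => ?_, (A α).2.2.2⟩
      rw [hA]
      show pullbackₗ γ _ = _
      rw [map_smul, map_sum]
      congr 1
      -- Pulling the average back by `γ` multiplies every class on the right by that of `γ`, which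
      -- only permutes the summands.
      refine Eq.trans (Finset.sum_congr rfl fun q _ => ?_) (Equiv.sum_comp
        (Equiv.mulRight ((⟨γ, hγ⟩ : Γ) : Holonomy Γ))
        fun q : Holonomy Γ => pullback (q.out : Iso n) (α : E n → PForm n p))
      show pullback γ (pullback (q.out : Iso n) (α : E n → PForm n p)) = _
      rw [← pullback_mul]
      refine h.pullback_eq_of_mk_eq (γ := q.out * ⟨γ, hγ⟩) α.2 ?_
      rw [QuotientGroup.out_eq', QuotientGroup.mk_mul, QuotientGroup.out_eq']
      rfl
    · apply Subtype.ext
      rw [hA, Finset.sum_congr rfl fun q _ => hα.2.1 _ (Quotient.out q).2, Finset.sum_const,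
        Finset.card_univ, ← hN, ← Nat.cast_smul_eq_nsmul ℂ, smul_smul, inv_mul_cancel₀ hN0,
        one_smul]
  rw [finrank_eq_trace_of_isProj (h.eigenforms_le p l) A hproj.1 hproj.2, map_smul, map_sum,
    smul_eq_mul]
  congr 1
  exact Finset.sum_congr rfl fun q _ => trace_eigenPullback (hs q) p l

end Multiplicity

/-! ### The lattice of frequencies fixed by a signed permutation. -/

section FixedLattice

variable {n : ℕ} {σ : Equiv.Perm (Fin n)} {ε : Fin n → ℤˣ}

lemma eq_of_sameCycle {ι β : Type*} [Finite ι] {σ : Equiv.Perm ι} {f : ι → β}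
    (h : ∀ i, f (σ i) = f i) {i j : ι} (hij : σ.SameCycle i j) : f i = f j := by
  have h1 (k : ℕ) : f ((σ ^ k) i) = f i := by
    induction k with
    | zero => rfl
    | succ k ih => rw [pow_succ', Equiv.Perm.mul_apply, h, ih]
  obtain ⟨k, -, hk⟩ := hij.exists_pow_eq'
  rw [← hk, h1]

lemma apply_perm_of_dualAct_eq {v : Fin n → ℤ} (hv : dualAct σ ε v = v) (i : Fin n) :
    v (σ i) = ε i * v i := by
  conv_rhs => rw [← hv]
  rw [dualAct, ← mul_assoc, ← Units.val_mul, Int.units_mul_self, Units.val_one, one_mul]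

/-- Moving along the cycle multiplies both entries by the same sign, and the signs cancel. With `u =
v` it says that the absolute value is constant on cycles. -/
lemma mul_eq_mul_of_sameCycle {u v : Fin n → ℤ} (hu : dualAct σ ε u = u)
    (hv : dualAct σ ε v = v) {i j : Fin n} (hij : σ.SameCycle i j) : u i * v i = u j * v j := by
  refine eq_of_sameCycle (f := fun i => u i * v i) (fun i => ?_) hij
  have h : (ε i : ℤ) * ε i = 1 := by
    rw [← Units.val_mul, Int.units_mul_self, Units.val_one]
  rw [apply_perm_of_dualAct_eq hu, apply_perm_of_dualAct_eq hv]
  linear_combination u i * v i * h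

/-- The lattice of integer vectors fixed by a signed permutation has a basis of vectors with
entries in `{0, ±1}` whose supports are distinct cycles of the permutation. -/
theorem exists_basis_fixed_lattice (σ : Equiv.Perm (Fin n)) (ε : Fin n → ℤˣ) :
    ∃ (κ : Type) (_ : Fintype κ) (w : κ → Fin n → ℤ),
      (∀ k, dualAct σ ε (w k) = w k) ∧ (∀ k, ∃ i, w k i ≠ 0) ∧
      (∀ k i, w k i ≠ 0 → w k i ^ 2 = 1) ∧
      (∀ k k', k ≠ k' → ∀ i, w k i * w k' i = 0) ∧
      (∀ k i j, w k i ≠ 0 → w k j ≠ 0 → σ.SameCycle i j) ∧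
      ∀ v, dualAct σ ε v = v → ∃ a : κ → ℤ, v = ∑ k, a k • w k := by
  classical
  let O := Quotient (Equiv.Perm.SameCycle.setoid σ)
  let mk : Fin n → O := fun i => Quotient.mk _ i
  have hmk {i j : Fin n} : mk i = mk j ↔ σ.SameCycle i j := Quotient.eq
  have hout (o : O) : mk o.out = o := Quotient.out_eq o
  -- The cycles that carry a nonzero fixed vector; going once around any other cycle would force a
  -- sign change.
  let κ := {o : O // ∃ v, dualAct σ ε v = v ∧ v o.out ≠ 0}
  choose u hu hu0 using fun k : κ => k.2
  -- The signs of a chosen fixed vector `u k` on its cycle, normalised to be `1` at the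
  -- representative. The coefficient of `v` along `w k` is therefore its entry at that
  -- representative.
  let w : κ → Fin n → ℤ := fun k i =>
    if mk i = k.1 then (u k i).sign * (u k k.1.out).sign else 0
  have hne (k : κ) (i : Fin n) (hi : mk i = k.1) : u k i ≠ 0 := by
    intro h0
    have h1 : mk i = mk k.1.out := by rw [hi, hout]
    have h2 := mul_eq_mul_of_sameCycle (hu k) (hu k) (hmk.mp h1)
    rw [h0, zero_mul, eq_comm, mul_self_eq_zero] at h2
    exact hu0 k h2
  have hmem {k : κ} {i : Fin n} (h : w k i ≠ 0) : mk i = k.1 := by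
    by_contra h0
    exact h (if_neg h0)
  have hsign {a : ℤ} (ha : a ≠ 0) : a.sign * a.sign = 1 := by
    rcases lt_or_gt_of_ne ha with h | h
    · simp [Int.sign_eq_neg_one_of_neg h]
    · simp [Int.sign_eq_one_of_pos h]
  refine ⟨κ, inferInstance, w, fun k => funext fun i => ?_, fun k => ⟨k.1.out, ?_⟩,
    fun k i h => ?_, fun k k' hk i => ?_, fun k i j hi hj => ?_, fun v hv => ?_⟩
  · have h1 : mk (σ i) = mk i := hmk.mpr (Equiv.Perm.SameCycle.rfl.apply_left)
    simp only [dualAct, w, h1]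
    split_ifs
    · have h2 : u k i = ε i * u k (σ i) := (congrFun (hu k) i).symm
      rw [h2, Int.sign_mul]
      rcases Int.units_eq_one_or (ε i) with h | h <;> simp [h]
    · simp
  · simp only [w, hout, if_true, hsign (hu0 k)]
    exact one_ne_zero
  · have h1 := hmem h
    simp only [w, if_pos h1]
    have h2 := hsign (hne k i h1)
    have h3 := hsign (hu0 k)
    linear_combination (u k k.1.out).sign ^ 2 * h2 + h3
  · by_cases h : mk i = k.1
    · have : mk i ≠ k'.1 := fun h' => hk (Subtype.ext (h.symm.trans h'))
      simp [w, this]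
    · simp [w, h]
  · exact hmk.mp ((hmem hi).trans (hmem hj).symm)
  · refine ⟨fun k => v k.1.out, funext fun i => ?_⟩
    rw [Finset.sum_apply]
    have hcyc : σ.SameCycle i (mk i).out := hmk.mp (hout (mk i)).symm
    by_cases hi : ∃ v, dualAct σ ε v = v ∧ v (mk i).out ≠ 0
    · rw [Finset.sum_eq_single ⟨mk i, hi⟩]
      · set k : κ := ⟨mk i, hi⟩
        have h1 : u k i ≠ 0 := hne k i rfl
        have h2 := mul_eq_mul_of_sameCycle hv (hu k) hcyc
        have h3 := mul_eq_mul_of_sameCycle (hu k) (hu k) hcyc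
        have h4 : |u k i| = |u k (mk i).out| := abs_eq_abs.mpr (mul_self_eq_mul_self_iff.mp h3)
        have h5 : (u k i).sign * |u k i| = u k i := Int.sign_mul_abs _
        have h6 : (u k (mk i).out).sign * |u k (mk i).out| = u k (mk i).out :=
          Int.sign_mul_abs _
        have h7 : v i * (u k i).sign = v (mk i).out * (u k (mk i).out).sign := by
          apply mul_right_cancel₀ (abs_ne_zero.mpr h1)
          rw [mul_assoc, mul_assoc, h5, h4, h6, h2]
        have h8 := hsign h1
        have h9 : w k i = (u k i).sign * (u k (mk i).out).sign := if_pos rfl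
        show v i = v (mk i).out * w k i
        rw [h9]
        linear_combination (u k i).sign * h7 - v i * h8
      · intro k _ hk
        have : mk i ≠ k.1 := fun h => hk (Subtype.ext h.symm)
        simp [w, this]
      · simp
    · push Not at hi
      have h1 := mul_eq_mul_of_sameCycle hv hv hcyc
      rw [hi v hv, mul_zero, mul_self_eq_zero] at h1
      rw [h1, eq_comm]
      refine Finset.sum_eq_zero fun k _ => ?_
      have : mk i ≠ k.1 := fun h => by
        obtain ⟨v', hv', h0⟩ := k.2
        rw [← h] at h0
        exact h0 (hi v' hv')
      simp [w, this]

/-- The number of nonzero entries of a vector. -/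
def supportCard (w : Fin n → ℤ) : ℕ := (Finset.univ.filter fun i => w i ≠ 0).card

lemma supportCard_le (w : Fin n → ℤ) : supportCard w ≤ n :=
  (Finset.card_filter_le _ _).trans (by simp)

lemma supportCard_pos {w : Fin n → ℤ} (h : ∃ i, w i ≠ 0) : 0 < supportCard w := by
  obtain ⟨i, hi⟩ := h
  exact Finset.card_pos.mpr ⟨i, by simp [hi]⟩

lemma sum_sq_eq_supportCard {w : Fin n → ℤ} (h : ∀ i, w i ≠ 0 → w i ^ 2 = 1) :
    ∑ i, w i ^ 2 = supportCard w := by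
  rw [supportCard, Finset.card_filter, Nat.cast_sum]
  refine Finset.sum_congr rfl fun i _ => ?_
  by_cases h0 : w i = 0
  · simp [h0]
  · simp [h0, h i h0]

lemma sum_mul_sum_smul {κ : Type*} [Fintype κ] {w : κ → Fin n → ℤ}
    (hw : ∀ k i, w k i ≠ 0 → w k i ^ 2 = 1) (hd : ∀ k k', k ≠ k' → ∀ i, w k i * w k' i = 0)
    (a : κ → ℤ) (k : κ) : ∑ i, w k i * (∑ j, a j • w j) i = a k * supportCard (w k) := by
  rw [← sum_sq_eq_supportCard (hw k), Finset.mul_sum]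
  refine Finset.sum_congr rfl fun i _ => ?_
  rw [Finset.sum_apply, Finset.mul_sum, Finset.sum_eq_single k]
  · simp
    ring
  · intro j _ hj
    have := hd k j hj.symm i
    simp only [Pi.smul_apply, smul_eq_mul]
    linear_combination a j * this
  · simp

/-- Disjoint supports make the basis orthogonal. The diagonal form of `|v|²` is what lets the heat
sum factor. -/
lemma sum_sq_sum_smul {κ : Type*} [Fintype κ] {w : κ → Fin n → ℤ}
    (hw : ∀ k i, w k i ≠ 0 → w k i ^ 2 = 1) (hd : ∀ k k', k ≠ k' → ∀ i, w k i * w k' i = 0)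
    (a : κ → ℤ) : ∑ i, ((∑ j, a j • w j) i) ^ 2 = ∑ k, a k ^ 2 * supportCard (w k) := by
  have h (i : Fin n) : ((∑ j, a j • w j) i) ^ 2 =
      ∑ k, a k * (w k i * (∑ j, a j • w j) i) := by
    rw [sq]
    nth_rewrite 1 [Finset.sum_apply]
    rw [Finset.sum_mul]
    refine Finset.sum_congr rfl fun k _ => ?_
    simp only [Pi.smul_apply, smul_eq_mul]
    ring
  simp_rw [h]
  rw [Finset.sum_comm]
  refine Finset.sum_congr rfl fun k _ => ?_
  rw [← Finset.mul_sum, sum_mul_sum_smul hw hd]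
  ring

end FixedLattice

/-! ### Integrality of the phases. -/

section Phase

variable {n : ℕ} {σ : Equiv.Perm (Fin n)} {ε : Fin n → ℤˣ} {Γ : Subgroup (Iso n)}
  {γ : Iso n} {w : Fin n → ℤ}

/-- The scalar product of an integer vector and a real one. -/
def pairing (w : Fin n → ℤ) (x : E n) : ℝ := ∑ i, (w i : ℝ) * x i

lemma pairing_intVec (w m : Fin n → ℤ) : pairing w (intVec m) = (∑ i, w i * m i : ℤ) := by
  simp [pairing]

lemma pairing_apply (hs : IsSignedPerm γ.linearIsometryEquiv σ ε) (hw : dualAct σ ε w = w)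
    (x : E n) : pairing w (γ x) = pairing w x + pairing w (γ 0) := by
  have h : pairing w (γ.linearIsometryEquiv x) = pairing w x := by
    unfold pairing
    rw [← Equiv.sum_comp σ]
    refine Finset.sum_congr rfl fun i _ => ?_
    rw [hs x i]
    conv_rhs => rw [← hw]
    simp only [dualAct]
    push_cast
    ring
  rw [apply_eq_linear_add γ x, ← h]
  simp only [pairing, PiLp.add_apply, mul_add, Finset.sum_add_distrib]

/-- A vector fixed by the transpose of `B` does not see `B`, so each application of `γ` adds the
same phase. When `γ ^ k` is a lattice translation, `k` times the phase is thus an integer. -/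
lemma pairing_pow_apply (hs : IsSignedPerm γ.linearIsometryEquiv σ ε) (hw : dualAct σ ε w = w)
    (k : ℕ) : pairing w ((γ ^ k) 0) = k * pairing w (γ 0) := by
  induction k with
  | zero => simp [pairing]
  | succ k ih =>
    rw [pow_succ']
    show pairing w (γ ((γ ^ k) 0)) = _
    rw [pairing_apply hs hw, ih]
    push_cast
    ring

lemma HasCanonicalLattice.exists_pow_apply_zero (h : HasCanonicalLattice Γ) (hγ : γ ∈ Γ) {k : ℕ}
    (hk : linearPart n γ ^ k = 1) : ∃ m, (γ ^ k) 0 = intVec m := by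
  rw [← map_pow] at hk
  obtain ⟨m, hm⟩ := h.mem_latticeGroup (Γ.pow_mem hγ k) hk
  exact ⟨m, by rw [hm, translation_apply, add_zero]⟩

lemma linearPart_pow_holonomyOrder (hγ : γ ∈ Γ) : linearPart n γ ^ holonomyOrder Γ = 1 := by
  have h1 : ((⟨γ, hγ⟩ ^ holonomyOrder Γ : Γ) : Holonomy Γ) = 1 := by
    rw [QuotientGroup.mk_pow]
    exact pow_card_eq_one'
  have h2 := (QuotientGroup.eq_one_iff _).mp h1
  have h3 : linearPart n ((⟨γ, hγ⟩ ^ holonomyOrder Γ : Γ) : Iso n) = 1 := h2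
  rw [← map_pow]
  exact h3

/-- The phase of an element of `Γ` along a fixed integer vector is a multiple of `1 / |F|`. -/
lemma HasCanonicalLattice.exists_int_eq_mul_pairing (h : HasCanonicalLattice Γ) (hγ : γ ∈ Γ)
    (hs : IsSignedPerm γ.linearIsometryEquiv σ ε) (hw : dualAct σ ε w = w) :
    ∃ k : ℤ, holonomyOrder Γ * pairing w (γ 0) = k := by
  obtain ⟨m, hm⟩ := h.exists_pow_apply_zero hγ
    (linearPart_pow_holonomyOrder hγ)
  rw [← pairing_pow_apply hs hw, hm, pairing_intVec]
  exact ⟨_, rfl⟩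

/-- The phase of an element of `Γ` along a fixed integer vector whose support is everything
is an integer. -/
lemma HasCanonicalLattice.exists_int_eq_pairing (h : HasCanonicalLattice Γ) (hγ : γ ∈ Γ)
    (hs : IsSignedPerm γ.linearIsometryEquiv σ ε) (hw : dualAct σ ε w = w)
    (hc : ∀ i j, w i ≠ 0 → w j ≠ 0 → σ.SameCycle i j) (hn : 0 < n) (hn' : supportCard w = n) :
    ∃ k : ℤ, pairing w (γ 0) = k := by
  have h0 (i : Fin n) : w i ≠ 0 := by
    have h1 : (Finset.univ.filter fun i => w i ≠ 0) = Finset.univ :=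
      (Finset.card_eq_iff_eq_univ _).mp (by simpa [supportCard] using hn')
    have := Finset.mem_univ i
    rw [← h1] at this
    exact (Finset.mem_filter.mp this).2
  have hcyc (i : Fin n) : (σ ^ n) i = i := by
    have h1 : σ.IsCycleOn (Finset.univ : Finset (Fin n)) :=
      ⟨by simp, fun i _ j _ => hc i j (h0 i) (h0 j)⟩
    simpa using h1.pow_card_apply (Finset.mem_univ i)
  -- Multiplying coordinates by the nonzero entries of `w` removes the signs: up to this rescaling,
  -- `B` just moves coordinates along the `n`-cycle `σ`. Hence `B ^ n = 1`.
  have hpow (k : ℕ) (x : E n) (i : Fin n) :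
      (linearPart n γ ^ k) x ((σ ^ k) i) * w ((σ ^ k) i) = w i * x i := by
    induction k with
    | zero => simp [mul_comm]
    | succ k ih =>
      rw [pow_succ', pow_succ']
      show γ.linearIsometryEquiv ((linearPart n γ ^ k) x) (σ ((σ ^ k) i)) * w (σ ((σ ^ k) i)) = _
      rw [hs, apply_perm_of_dualAct_eq hw]
      have h1 : (((ε ((σ ^ k) i) : ℤ) * ε ((σ ^ k) i) : ℤ) : ℝ) = 1 := by
        rw [← Units.val_mul, Int.units_mul_self]
        simp
      push_cast at h1 ⊢
      rw [← ih]
      linear_combination (linearPart n γ ^ k) x ((σ ^ k) i) * w ((σ ^ k) i) * h1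
  have hB : linearPart n γ ^ n = 1 := by
    ext x i
    have h1 := hpow n x i
    rw [hcyc, mul_comm] at h1
    exact mul_left_cancel₀ (Int.cast_ne_zero.mpr (h0 i)) h1
  obtain ⟨m, hm⟩ := h.exists_pow_apply_zero hγ hB
  -- `γ` commutes with `γ ^ n`, the translation by `m`, so `B` fixes `m`. Then `w i * m i` is
  -- constant, and `n` times the phase is `n` times this integer.
  have hfix : γ.linearIsometryEquiv (intVec m) = intVec m := by
    have h1 : γ ((γ ^ n) 0) = (γ ^ n) (γ 0) := by
      show (γ * γ ^ n) 0 = (γ ^ n * γ) 0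
      rw [← pow_succ', ← pow_succ]
    have h2 : (γ ^ n).linearIsometryEquiv = 1 := by
      rw [← hB, ← map_pow]
      rfl
    rw [apply_eq_linear_add (γ ^ n) (γ 0), h2, hm, apply_eq_linear_add γ (intVec m),
      add_comm] at h1
    exact add_left_cancel h1
  have hmfix : dualAct σ ε m = m := by
    funext i
    have h1 := hs (intVec m) i
    rw [hfix] at h1
    simp only [intVec_apply] at h1
    have h2 : m (σ i) = ε i * m i := by exact_mod_cast h1
    rw [dualAct, h2, ← mul_assoc, ← Units.val_mul, Int.units_mul_self, Units.val_one, one_mul]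
  have hsum : ∑ i, w i * m i = n * (w ⟨0, hn⟩ * m ⟨0, hn⟩) := by
    rw [Finset.sum_congr rfl fun i _ => mul_eq_mul_of_sameCycle hw hmfix
      (hc i ⟨0, hn⟩ (h0 _) (h0 _))]
    simp
  refine ⟨w ⟨0, hn⟩ * m ⟨0, hn⟩, ?_⟩
  have h1 := pairing_pow_apply hs hw n
  rw [hm, pairing_intVec, hsum, Int.cast_mul, Int.cast_natCast] at h1
  exact (mul_left_cancel₀ (Nat.cast_ne_zero.mpr hn.ne') h1).symm

end Phase

/-! ### Products of absolutely convergent series. -/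

section ProductSums

/-- The product of the series `∑ f k m` converges absolutely as a multiple series. -/
def ProdSumFormula (κ : Type) [Fintype κ] (f : κ → ℤ → ℂ) : Prop :=
  (Summable fun a : κ → ℤ => ‖∏ k, f k (a k)‖) ∧
    ∑' a : κ → ℤ, ∏ k, f k (a k) = ∏ k, ∑' m, f k m

lemma ProdSumFormula.of_equiv {κ α : Type} [Fintype κ] [Fintype α] (e : α ≃ κ) {f : κ → ℤ → ℂ}
    (h : ProdSumFormula α fun k => f (e k)) : ProdSumFormula κ f := by
  obtain ⟨h1, h2⟩ := h
  let E := Equiv.arrowCongr e.symm (Equiv.refl ℤ)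
  have hE (a : κ → ℤ) : ∏ k, f (e k) (E a k) = ∏ k, f k (a k) :=
    Equiv.prod_comp e fun k => f k (a k)
  constructor
  · rw [← E.summable_iff] at h1
    exact h1.congr fun a => by rw [Function.comp, hE]
  · rw [← Equiv.prod_comp e fun k => ∑' m, f k m, ← h2, ← E.tsum_eq]
    exact tsum_congr fun a => (hE a).symm

/-- A family indexed by `Option κ` is a pair of its value at `none` and the other values. -/
def optionFamilyEquiv (κ β : Type) : (Option κ → β) ≃ β × (κ → β) where
  toFun a := (a none, fun k => a (some k))
  invFun x o := o.elim x.1 x.2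
  left_inv a := by
    funext o
    cases o <;> rfl
  right_inv _ := rfl

lemma ProdSumFormula.option {κ : Type} [Fintype κ] {f : Option κ → ℤ → ℂ}
    (h : ProdSumFormula κ fun k => f (some k)) (hf : Summable fun m => ‖f none m‖) :
    ProdSumFormula (Option κ) f := by
  obtain ⟨h1, h2⟩ := h
  let E := optionFamilyEquiv κ ℤ
  let g : ℤ × (κ → ℤ) → ℂ := fun x => f none x.1 * ∏ k, f (some k) (x.2 k)
  have hE (a : Option κ → ℤ) : g (E a) = ∏ k, f k (a k) :=
    (Fintype.prod_option fun k => f k (a k)).symm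
  have hg : Summable fun x => ‖g x‖ :=
    Summable.mul_norm (f := f none) (g := fun a : κ → ℤ => ∏ k, f (some k) (a k)) hf h1
  constructor
  · exact (E.summable_iff.mpr hg).congr fun a => by rw [Function.comp, hE]
  · rw [Fintype.prod_option, ← h2, tsum_mul_tsum_of_summable_norm (f := f none)
      (g := fun a : κ → ℤ => ∏ k, f (some k) (a k)) hf h1, ← E.tsum_eq]
    exact tsum_congr fun a => (hE a).symm

theorem prodSumFormula (κ : Type) [Fintype κ] (f : κ → ℤ → ℂ)
    (hf : ∀ k, Summable fun m => ‖f k m‖) : ProdSumFormula κ f := by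
  revert f
  refine Fintype.induction_empty_option (P := fun κ _ => ∀ f : κ → ℤ → ℂ,
    (∀ k, Summable fun m => ‖f k m‖) → ProdSumFormula κ f) ?_ ?_ ?_ κ
  · intro α κ _ e h f hf
    let := Fintype.ofEquiv κ e.symm
    exact .of_equiv e (h _ fun k => hf _)
  · intro f _
    exact ⟨(hasSum_fintype _).summable, by simp⟩
  · intro κ _ h f hf
    exact .option (h _ fun k => hf _) (hf none)

end ProductSums

/-! ### Theta inversion and the case `d = 4`. -/

section Theta

/-- The theta series `∑ exp (2 π i m c - 4 π² d m² s)`. -/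
def latticeTheta (d : ℕ) (c : ℝ) (s : ℂ) : ℂ :=
  ∑' m : ℤ, Complex.exp (2 * Real.pi * Complex.I * (m * c)) *
    Complex.exp (-(4 * Real.pi ^ 2 * (m ^ 2 * d) * s))

lemma summable_norm_latticeTheta {d : ℕ} (hd : 0 < d) (c : ℝ) {s : ℂ} (hs : 0 < s.re) :
    Summable fun m : ℤ => ‖Complex.exp (2 * Real.pi * Complex.I * (m * c)) *
      Complex.exp (-(4 * Real.pi ^ 2 * (m ^ 2 * d) * s))‖ := by
  have h := (summable_jacobiTheta₂_term_iff c (4 * Real.pi * d * (s * Complex.I))).mpr (by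
    have : (4 * Real.pi * d * (s * Complex.I)).im = 4 * Real.pi * d * s.re := by
      rw [show (4 * Real.pi * d * (s * Complex.I) : ℂ) =
        ((4 * Real.pi * d : ℝ) : ℂ) * (s * Complex.I) by push_cast; ring, Complex.im_ofReal_mul]
      simp
    rw [this]
    positivity)
  refine h.norm.congr fun m => ?_
  rw [jacobiTheta₂_term, ← Complex.exp_add]
  congr 2
  linear_combination (4 * Real.pi ^ 2 * m ^ 2 * d * s) * Complex.I_sq

lemma phi_add_int (d : ℕ) (r : ℝ) (k : ℤ) (s : ℂ) : phi d (r + k) s = phi d r s := by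
  unfold phi
  conv_rhs => rw [← (Equiv.addRight k).tsum_eq]
  refine tsum_congr fun m => ?_
  simp only [Equiv.coe_addRight]
  push_cast
  ring_nf

/-- A positive real factor leaves the argument unchanged, so it leaves the principal branch without
a phase. -/
lemma cpow_natCast_mul {d : ℕ} (hd : 0 < d) {z : ℂ} (hz : z ≠ 0) :
    ((d : ℂ) * z) ^ (1 / 2 : ℂ) = ((√(d : ℝ) : ℝ) : ℂ) * z ^ (1 / 2 : ℂ) := by
  have hd' : (0 : ℝ) < d := Nat.cast_pos.mpr hd
  have hd0 : (d : ℂ) ≠ 0 := Nat.cast_ne_zero.mpr hd.ne'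
  rw [Complex.cpow_def_of_ne_zero (mul_ne_zero hd0 hz), Complex.cpow_def_of_ne_zero hz,
    ← Complex.ofReal_natCast, Complex.log_ofReal_mul hd' hz, add_mul, Complex.exp_add,
    Real.sqrt_eq_rpow, Real.rpow_def_of_pos hd']
  push_cast
  rfl

/-- The inversion formula for the theta series. -/
theorem latticeTheta_eq {d : ℕ} (hd : 0 < d) (c : ℝ) {s : ℂ} (hs : 0 < s.re) :
    latticeTheta d c s = ((√(d : ℝ) : ℝ) : ℂ)⁻¹ * zFun d c s := by
  have hs0 : s ≠ 0 := fun h => by simp [h] at hs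
  have ha : 0 < ((d : ℂ) * (4 * Real.pi * s)).re := by
    rw [show ((d : ℂ) * (4 * Real.pi * s)) = ((d * (4 * Real.pi) : ℝ) : ℂ) * s by
      push_cast; ring, Complex.re_ofReal_mul]
    positivity
  -- The linear parameter `-ic` is chosen so that inversion shifts the Gaussian by `i (-ic) = c`;
  -- its sign is matched below by replacing `m` with `-m`.
  have h := Complex.tsum_exp_neg_quadratic ha (-(Complex.I * c))
  rw [cpow_natCast_mul hd (mul_ne_zero (mul_ne_zero (by norm_num)
    (Complex.ofReal_ne_zero.mpr Real.pi_ne_zero)) hs0)] at h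
  have h1 : latticeTheta d c s = ∑' m : ℤ, Complex.exp (-Real.pi * (d * (4 * Real.pi * s)) *
      m ^ 2 + 2 * Real.pi * -(Complex.I * c) * m) := by
    rw [latticeTheta, ← (Equiv.neg ℤ).tsum_eq]
    refine tsum_congr fun m => ?_
    rw [← Complex.exp_add, Equiv.neg_apply]
    congr 1
    push_cast
    ring
  have h2 : (∑' m : ℤ, Complex.exp (-Real.pi / (d * (4 * Real.pi * s)) *
      (m + Complex.I * -(Complex.I * c)) ^ 2)) = phi d c (1 / (4 * s)) := by
    refine tsum_congr fun m => ?_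
    congr 1
    have hd0 : ((√(d : ℝ) : ℝ) : ℂ) ^ 2 = d := by
      rw [← Complex.ofReal_pow, Real.sq_sqrt (Nat.cast_nonneg d), Complex.ofReal_natCast]
    have h3 : (m + Complex.I * -(Complex.I * c)) = (m + c : ℂ) := by
      linear_combination (-c : ℂ) * Complex.I_sq
    have hd1 : (d : ℂ) ≠ 0 := Nat.cast_ne_zero.mpr hd.ne'
    have hpi : (Real.pi : ℂ) ≠ 0 := Complex.ofReal_ne_zero.mpr Real.pi_ne_zero
    rw [h3]
    push_cast
    rw [div_pow, hd0]
    field_simp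
  rw [h1, h, h2, zFun, sqrtFourPi]
  field_simp

lemma summable_gaussian {t : ℂ} (ht : 0 < t.re) (r : ℝ) :
    Summable fun m : ℤ => Complex.exp (-t * (m + r) ^ 2) := by
  have h := (summable_jacobiTheta₂_term_iff (t * r * Complex.I / Real.pi)
    (t * Complex.I / Real.pi)).mpr (by
      rw [show t * Complex.I / Real.pi = ((Real.pi⁻¹ : ℝ) : ℂ) * (t * Complex.I) by
        push_cast; ring, Complex.im_ofReal_mul]
      simp only [Complex.mul_I_im]
      positivity)
  refine (h.mul_left (Complex.exp (-t * r ^ 2))).congr fun m => ?_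
  rw [jacobiTheta₂_term, ← Complex.exp_add]
  congr 1
  have hpi : (Real.pi : ℂ) ≠ 0 := Complex.ofReal_ne_zero.mpr Real.pi_ne_zero
  field_simp
  linear_combination (t * m * (2 * r + m)) * Complex.I_sq

/-- The terms are Gaussians at `m / 2`: even `m` gives `theta0` and odd `m` gives `theta1`. -/
lemma phi_four {t : ℂ} (ht : 0 < t.re) : phi 4 0 t = theta0 t + theta1 t := by
  have h4 : √((4 : ℕ) : ℝ) = 2 := by
    rw [show ((4 : ℕ) : ℝ) = 2 ^ 2 by norm_num]
    exact Real.sqrt_sq (by norm_num)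
  have h0 : HasSum (fun m : ℤ => Complex.exp (-t * (m : ℂ) ^ 2)) (theta0 t) := by
    refine Summable.hasSum ?_
    simpa using summable_gaussian ht 0
  have h1 : HasSum (fun m : ℤ => Complex.exp (-t * (1 / 2 + (m : ℂ)) ^ 2)) (theta1 t) := by
    refine Summable.hasSum ?_
    have := summable_gaussian ht (1 / 2)
    refine this.congr fun m => ?_
    push_cast
    rw [add_comm]
  have hi0 : Function.Injective fun m : ℤ => 2 * m := fun a b h => by
    simpa using h
  have hi1 : Function.Injective fun m : ℤ => 2 * m + 1 := fun a b h => by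
    simpa using h
  have hr0 : Set.range (fun m : ℤ => 2 * m) = {m | Even m} := by
    ext m
    simp [even_iff_two_dvd, dvd_def, @eq_comm _ m]
  have hr1 : Set.range (fun m : ℤ => 2 * m + 1) = {m | Odd m} := by
    ext m
    simp [Odd, @eq_comm _ m]
  let f : ℤ → ℂ := fun m => Complex.exp (-t * (((m + 0) / √((4 : ℕ) : ℝ) : ℝ) : ℂ) ^ 2)
  have k0 : HasSum (f ∘ fun m : ℤ => 2 * m) (theta0 t) := by
    convert h0 using 2 with m
    simp only [f, h4, Function.comp]
    push_cast
    ring_nf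
  have k1 : HasSum (f ∘ fun m : ℤ => 2 * m + 1) (theta1 t) := by
    convert h1 using 2 with m
    simp only [f, h4, Function.comp]
    push_cast
    ring_nf
  have := (hi0.hasSum_range_iff.mpr k0).add_isCompl
    (by rw [hr0, hr1]; exact Int.isCompl_even_odd) (hi1.hasSum_range_iff.mpr k1)
  exact this.tsum_eq

lemma zFun_add_int (d : ℕ) (r : ℝ) (k : ℤ) (s : ℂ) : zFun d (r + k) s = zFun d r s := by
  rw [zFun, phi_add_int, zFun]

lemma zFun_four {s : ℂ} (hs : 0 < s.re) (k : ℤ) : zFun 4 k s = xFun s + yFun s := by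
  have ht : 0 < (1 / (4 * s)).re := by
    rw [one_div, Complex.inv_re]
    have : s ≠ 0 := fun h => by simp [h] at hs
    have h2 : 0 < Complex.normSq (4 * s) := Complex.normSq_pos.mpr (by simpa using this)
    have h3 : (4 * s).re = 4 * s.re := by simp
    rw [h3]
    positivity
  rw [← zero_add (k : ℝ), zFun_add_int, zFun, phi_four ht, add_div, xFun, yFun]

end Theta

/-! ### Polynomial expressions over `K` in the theta functions. -/

section HeatPolynomials

/-- Functions on the right half-plane that are polynomials over `K` in the functions `x`, `y`
and `z`. -/
def IsHeatPolynomial (N : ℕ) (f : ℂ → ℂ) : Prop :=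
  ∃ P : MvPolynomial (HeatVar N) K, ∀ s : ℂ, 0 < s.re →
    f s = MvPolynomial.aeval (HeatVar.value s) P

variable {N : ℕ}

lemma IsHeatPolynomial.congr {f g : ℂ → ℂ} (hf : IsHeatPolynomial N f)
    (h : ∀ s : ℂ, 0 < s.re → g s = f s) : IsHeatPolynomial N g := by
  obtain ⟨P, hP⟩ := hf
  exact ⟨P, fun s hs => by rw [h s hs, hP s hs]⟩

lemma IsHeatPolynomial.add {f g : ℂ → ℂ} (hf : IsHeatPolynomial N f)
    (hg : IsHeatPolynomial N g) : IsHeatPolynomial N fun s => f s + g s := by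
  obtain ⟨P, hP⟩ := hf
  obtain ⟨Q, hQ⟩ := hg
  exact ⟨P + Q, fun s hs => by simp only [hP s hs, hQ s hs, map_add]⟩

lemma IsHeatPolynomial.mul {f g : ℂ → ℂ} (hf : IsHeatPolynomial N f)
    (hg : IsHeatPolynomial N g) : IsHeatPolynomial N fun s => f s * g s := by
  obtain ⟨P, hP⟩ := hf
  obtain ⟨Q, hQ⟩ := hg
  exact ⟨P * Q, fun s hs => by simp only [hP s hs, hQ s hs, map_mul]⟩

lemma IsHeatPolynomial.const {c : ℂ} (hc : c ∈ K) : IsHeatPolynomial N fun _ => c :=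
  ⟨MvPolynomial.C ⟨c, hc⟩, fun s _ => (MvPolynomial.aeval_C (HeatVar.value s) (⟨c, hc⟩ : K)).symm⟩

lemma IsHeatPolynomial.var (v : HeatVar N) : IsHeatPolynomial N fun s => HeatVar.value s v :=
  ⟨MvPolynomial.X v, fun _ _ => (MvPolynomial.aeval_X _ _).symm⟩

lemma IsHeatPolynomial.sum {ι : Type*} (S : Finset ι) {f : ι → ℂ → ℂ}
    (hf : ∀ i, IsHeatPolynomial N (f i)) : IsHeatPolynomial N fun s => ∑ i ∈ S, f i s := by
  choose P hP using hf
  exact ⟨∑ i ∈ S, P i, fun s hs => by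
    rw [map_sum]
    exact Finset.sum_congr rfl fun i _ => hP i s hs⟩

lemma IsHeatPolynomial.prod {ι : Type*} (S : Finset ι) {f : ι → ℂ → ℂ}
    (hf : ∀ i, IsHeatPolynomial N (f i)) : IsHeatPolynomial N fun s => ∏ i ∈ S, f i s := by
  choose P hP using hf
  exact ⟨∏ i ∈ S, P i, fun s hs => by
    rw [map_prod]
    exact Finset.prod_congr rfl fun i _ => hP i s hs⟩

lemma sqrt_natCast_mem_K {d : ℕ} (h0 : 0 < d) (h : d ≤ 4) : ((√(d : ℝ) : ℝ) : ℂ) ∈ K := by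
  interval_cases d
  · simp only [Nat.cast_one, Real.sqrt_one, Complex.ofReal_one]
    exact K.one_mem
  · exact IntermediateField.subset_adjoin ℚ _ (by simp)
  · exact IntermediateField.subset_adjoin ℚ _ (by simp)
  · rw [show ((4 : ℕ) : ℝ) = 2 ^ 2 by norm_num, Real.sqrt_sq (by norm_num)]
    exact_mod_cast natCast_mem K 2

lemma isHeatPolynomial_zFun (hN : 0 < N) {d : ℕ} (h0 : 0 < d) (h : d ≤ 3) {c : ℝ} {k : ℤ}
    (hc : N * c = k) : IsHeatPolynomial N (zFun d c) := by
  have hN' : (N : ℝ) ≠ 0 := Nat.cast_ne_zero.mpr hN.ne'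
  have hNZ : (N : ℤ) ≠ 0 := Nat.cast_ne_zero.mpr hN.ne'
  -- `zFun` has period one in its shift, so `k` may be reduced modulo `N` to an admissible index.
  obtain ⟨r, hr⟩ := Int.eq_ofNat_of_zero_le (Int.emod_nonneg k hNZ)
  have hr' : r < N := by
    have := Int.emod_lt_of_pos k (Nat.cast_pos.mpr hN)
    omega
  have hcr : c = (r : ℝ) / N + ((k / N : ℤ) : ℝ) := by
    have h1 : (k : ℝ) = (r : ℝ) + N * ((k / N : ℤ) : ℝ) := by
      have h2 : k = r + N * (k / N) := by
        rw [← hr, Int.emod_add_mul_ediv]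
      exact_mod_cast congrArg (Int.cast (R := ℝ)) h2
    field_simp
    linarith
  refine (IsHeatPolynomial.var (.z ⟨d - 1, by omega⟩ ⟨r, hr'⟩)).congr fun s _ => ?_
  rw [hcr, zFun_add_int]
  simp only [HeatVar.value]
  congr 1
  omega

lemma isHeatPolynomial_latticeTheta (hN : 0 < N) {d : ℕ} (h0 : 0 < d) (h : d ≤ 4) {c : ℝ}
    (hc : ∃ k : ℤ, N * c = k) (hc4 : d = 4 → ∃ k : ℤ, c = k) :
    IsHeatPolynomial N (latticeTheta d c) := by
  have hz : IsHeatPolynomial N (zFun d c) := by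
    rcases h.eq_or_lt with rfl | h4
    · obtain ⟨k, rfl⟩ := hc4 rfl
      exact ((IsHeatPolynomial.var .x).add (.var .y)).congr fun s hs => zFun_four hs k
    · obtain ⟨k, hk⟩ := hc
      exact isHeatPolynomial_zFun hN h0 (by omega) hk
  exact ((IsHeatPolynomial.const (K.inv_mem (sqrt_natCast_mem_K h0 h))).mul hz).congr
    fun s hs => latticeTheta_eq h0 c hs

end HeatPolynomials

/-! ### Assembly of the heat trace. -/

section HeatTrace

variable {n : ℕ} {σ : Equiv.Perm (Fin n)} {ε : Fin n → ℤˣ} {Γ : Subgroup (Iso n)}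

lemma character_eq_exp_pairing (v : Fin n → ℤ) (x : E n) :
    character v x = Complex.exp (2 * Real.pi * Complex.I * pairing v x) := by
  simp [character, pairing]

lemma pairing_sum_smul {κ : Type*} [Fintype κ] (w : κ → Fin n → ℤ) (a : κ → ℤ) (x : E n) :
    pairing (∑ k, a k • w k) x = ∑ k, a k * pairing (w k) x := by
  simp only [pairing, Finset.sum_apply, Pi.smul_apply, smul_eq_mul, Int.cast_sum, Int.cast_mul,
    Finset.sum_mul, Finset.mul_sum]
  rw [Finset.sum_comm]
  simp only [mul_assoc]

lemma dualAct_sum_smul {κ : Type*} [Fintype κ] {w : κ → Fin n → ℤ}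
    (hw : ∀ k, dualAct σ ε (w k) = w k) (a : κ → ℤ) :
    dualAct σ ε (∑ k, a k • w k) = ∑ k, a k • w k := by
  funext i
  simp only [dualAct, Finset.sum_apply, Pi.smul_apply, smul_eq_mul, Finset.mul_sum]
  refine Finset.sum_congr rfl fun k _ => ?_
  conv_rhs => rw [← hw k]
  simp only [dualAct]
  ring

/-- The sum of the heat kernel weights over the frequencies fixed by a signed permutation is a
product of one-dimensional theta series, one for each basis vector. -/
lemma hasSum_fixed {κ : Type} [Fintype κ] {w : κ → Fin n → ℤ}
    (hw : ∀ k, dualAct σ ε (w k) = w k) (hne : ∀ k, ∃ i, w k i ≠ 0)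
    (hsq : ∀ k i, w k i ≠ 0 → w k i ^ 2 = 1) (hd : ∀ k k', k ≠ k' → ∀ i, w k i * w k' i = 0)
    (hspan : ∀ v, dualAct σ ε v = v → ∃ a : κ → ℤ, v = ∑ k, a k • w k) (x : E n) {s : ℂ}
    (hs : 0 < s.re) :
    HasSum (fun v : Fin n → ℤ => if dualAct σ ε v = v then
      character v x * Complex.exp (-(eigenvalue v * s)) else 0)
      (∏ k, latticeTheta (supportCard (w k)) (pairing (w k) x) s) := by
  let g : (κ → ℤ) → Fin n → ℤ := fun a => ∑ k, a k • w k
  have hg : Function.Injective g := by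
    intro a b hab
    funext k
    have ha := sum_mul_sum_smul hsq hd a k
    have hb := sum_mul_sum_smul hsq hd b k
    have h1 : (supportCard (w k) : ℤ) ≠ 0 := by exact_mod_cast (supportCard_pos (hne k)).ne'
    apply mul_right_cancel₀ h1
    rw [← ha, ← hb]
    exact Finset.sum_congr rfl fun i _ => congrArg (w k i * ·) (congrFun hab i)
  -- The summand vanishes off the fixed lattice, so the sum is taken over coordinates `a` in its
  -- basis.
  rw [← hg.hasSum_iff]
  · obtain ⟨h1, h2⟩ := prodSumFormula κ _ fun k =>
      summable_norm_latticeTheta (supportCard_pos (hne k)) (pairing (w k) x) hs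
    have h3 := h1.of_norm.hasSum
    rw [h2] at h3
    refine h3.congr_fun fun a => ?_
    have h4 : eigenvalue (g a) = 4 * Real.pi ^ 2 *
        ∑ k, (a k : ℝ) ^ 2 * (supportCard (w k) : ℝ) := by
      rw [eigenvalue]
      congr 1
      exact_mod_cast congrArg (Int.cast (R := ℝ)) (sum_sq_sum_smul hsq hd a)
    rw [Function.comp, if_pos (dualAct_sum_smul hw a), character_eq_exp_pairing, pairing_sum_smul,
      h4, Finset.prod_mul_distrib, ← Complex.exp_sum, ← Complex.exp_sum]
    push_cast
    simp only [Finset.mul_sum, Finset.sum_mul, Finset.sum_neg_distrib]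
  · intro v hv
    refine if_neg fun h => hv ?_
    obtain ⟨a, ha⟩ := hspan v h
    exact ⟨a, ha.symm⟩

lemma trace_formPullback_mem_K {B : E n ≃ₗᵢ[ℝ] E n} (h : IsSignedPerm B σ ε) (p : ℕ) :
    LinearMap.trace ℂ (PForm n p) (formPullback B) ∈ K := by
  obtain ⟨r, hr⟩ := exists_rat_eq_trace_formPullback (p := p) B h.exists_int
  rw [hr]
  exact K.algebraMap_mem r

/-- Dimension four enters here: every basis vector has between one and four nonzero entries, and
four means full support, where the phase is an integer. -/
lemma exists_heatPolynomial_fixed {Γ : Subgroup (Iso 4)} (h : HasCanonicalLattice Γ)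
    {γ : Iso 4} (hγ : γ ∈ Γ) {σ : Equiv.Perm (Fin 4)} {ε : Fin 4 → ℤˣ}
    (hs : IsSignedPerm γ.linearIsometryEquiv σ ε) :
    ∃ f, IsHeatPolynomial (holonomyOrder Γ) f ∧ ∀ s : ℂ, 0 < s.re →
      HasSum (fun v : Fin 4 → ℤ => if dualAct σ ε v = v then
        character v (γ 0) * Complex.exp (-(eigenvalue v * s)) else 0) (f s) := by
  obtain ⟨κ, _, w, hw, hne, hsq, hd, hc, hspan⟩ := exists_basis_fixed_lattice σ ε
  refine ⟨_, ?_, fun s => hasSum_fixed hw hne hsq hd hspan (γ 0)⟩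
  have := h.finite_holonomy
  exact .prod _ fun k => isHeatPolynomial_latticeTheta Nat.card_pos (supportCard_pos (hne k))
    (supportCard_le _) (h.exists_int_eq_mul_pairing hγ hs (hw k))
    fun hk => h.exists_int_eq_pairing hγ hs (hw k) (hc k) (by norm_num) hk

/-- Summation along the fibres of a function with finite fibres. -/
lemma hasSum_sum_fiber {α β : Type*} {φ : α → β} {G : α → ℂ} {a : ℂ} (h : HasSum G a)
    (S : β → Finset α) (hS : ∀ v b, v ∈ S b ↔ φ v = b) : HasSum (fun b => ∑ v ∈ S b, G v) a := by
  have h1 : HasSum (fun x : Σ b, {v // φ v = b} => G x.2) a :=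
    (Equiv.sigmaFiberEquiv φ).hasSum_iff.mpr h
  refine HasSum.sigma h1 fun b => ?_
  let e : {v // φ v = b} ≃ {v // v ∈ S b} := Equiv.subtypeEquivRight fun v => (hS v b).symm
  exact e.hasSum_iff.mpr (Finset.hasSum (S b) G)

lemma HasCanonicalLattice.heatTerm_eq (h : HasCanonicalLattice Γ)
    [Fintype (Holonomy Γ)] {σ : Holonomy Γ → Equiv.Perm (Fin n)} {ε : Holonomy Γ → Fin n → ℤˣ}
    (hs : ∀ q : Holonomy Γ, IsSignedPerm (q.out : Iso n).linearIsometryEquiv (σ q) (ε q))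
    (p : ℕ) (s : ℂ) (l : ℝ) :
    heatTerm Γ p s l = ∑ v ∈ frequencies n l, (holonomyOrder Γ : ℂ)⁻¹ * ∑ q : Holonomy Γ,
      LinearMap.trace ℂ (PForm n p) (formPullback (q.out : Iso n).linearIsometryEquiv) *
        if dualAct (σ q) (ε q) v = v then
          character v ((q.out : Iso n) 0) * Complex.exp (-(eigenvalue v * s)) else 0 := by
  rw [heatTerm, h.finrank_eigenforms hs, Finset.sum_comm, mul_assoc, Finset.sum_mul,
    Finset.mul_sum]
  refine Finset.sum_congr rfl fun v hv => ?_
  rw [Finset.sum_mul]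
  congr 1
  refine Finset.sum_congr rfl fun q _ => ?_
  rw [mem_frequencies.mp hv]
  split_ifs <;> ring

/-- The heat trace as a sum over the holonomy group. -/
lemma HasCanonicalLattice.hasSum_heatTerm (h : HasCanonicalLattice Γ)
    [Fintype (Holonomy Γ)] {σ : Holonomy Γ → Equiv.Perm (Fin n)} {ε : Holonomy Γ → Fin n → ℤˣ}
    (hs : ∀ q : Holonomy Γ, IsSignedPerm (q.out : Iso n).linearIsometryEquiv (σ q) (ε q))
    (p : ℕ) {s : ℂ} {f : Holonomy Γ → ℂ}
    (hf : ∀ q, HasSum (fun v : Fin n → ℤ => if dualAct (σ q) (ε q) v = v then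
        character v ((q.out : Iso n) 0) * Complex.exp (-(eigenvalue v * s)) else 0) (f q)) :
    HasSum (heatTerm Γ p s) ((holonomyOrder Γ : ℂ)⁻¹ * ∑ q : Holonomy Γ,
      LinearMap.trace ℂ (PForm n p) (formPullback (q.out : Iso n).linearIsometryEquiv) * f q) := by
  rw [funext (h.heatTerm_eq hs p s)]
  -- The sum over eigenvalues is the absolutely convergent sum over frequencies, grouped by the
  -- finite fibres of `eigenvalue`.
  refine hasSum_sum_fiber (φ := eigenvalue) (HasSum.mul_left _ (hasSum_sum fun q _ => ?_)) _
    fun v l => mem_frequencies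
  exact (hf q).mul_left _

end HeatTrace

end FlatManifold

end

open FlatManifold in
theorem proposition3p4 (Γ : Subgroup (Iso 4)) (hΓ : IsBieberbach Γ)
    (hΛ : HasCanonicalLattice Γ) (p : ℕ) (hp : p ≤ 4) :
    (∀ l : ℝ, FiniteDimensional ℂ (eigenforms Γ p l)) ∧
    (∀ s : ℂ, 0 < s.re → Summable (heatTerm Γ p s)) ∧
    ∃ P : MvPolynomial (HeatVar (holonomyOrder Γ)) K,
      ∀ s : ℂ, 0 < s.re →
        heatTrace Γ p s = MvPolynomial.aeval (HeatVar.value s) P := by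
  have := hΛ.finite_holonomy
  let := Fintype.ofFinite (Holonomy Γ)
  choose σ ε hs using fun q : Holonomy Γ => hΛ.exists_isSignedPerm q.out.2
  choose f hf hsum using fun q : Holonomy Γ => exists_heatPolynomial_fixed hΛ q.out.2 (hs q)
  have hheat (s : ℂ) (h : 0 < s.re) := hΛ.hasSum_heatTerm hs p fun q => hsum q s h
  refine ⟨hΛ.finiteDimensional_eigenforms p, fun s h => (hheat s h).summable, ?_⟩
  exact ((IsHeatPolynomial.const (K.inv_mem (natCast_mem K _))).mul (.sum Finset.univ fun q =>
    (IsHeatPolynomial.const (trace_formPullback_mem_K (hs q) p)).mul (hf q))).congr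
    fun s h => (hheat s h).tsum_eq
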